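/- Let $n\ge 0$, let $\mathbb F=\mathbb Q(q,t)$, and let $\iota$ be the field automorphism of $\mathbb F$ with $\iota(q)=q^{-1}$, $\iota(t)=t^{-1}$. For $f\in\mathbb F[x]=\mathbb F[x_1,\dots,x_n]$ let $f^\circ$ be the polynomial obtained by applying $\iota$ to the coefficients of $f$. The symmetric group $S_n$ acts on $\mathbb F[x]$ and on $\mathbb F(x)$ by permuting the variables; $s_i$ interchanges $x_i$ and $x_{i+1}$, and $w_0\in S_n$ is the longest element $i\mapsto n+1-i$. The Demazure–Lusztig operators on $\mathbb F(x)$ are $$H_i=t\,s_i-\frac{(1-t)x_i}{x_i-x_{i+1}}(1-s_i),\qquad 1\le i<n,$$ and $H_w=H_{i_1}\cdots H_{i_\ell}$ for any reduced expression $w=s_{i_1}\cdots s_{i_\ell}$; $H_i^\circ$ and $H_w^\circ$ are these operators with $t$ replaced by $t^{-1}$. For $v\in\mathbb Z^n$ put $\overline v=(\overline v_1,\dots,\overline v_n)$ with $\overline v_i=q^{v_i}t^{-k_i(v)}$, where $k_i(v)=\#\{k<i\mid v_k\ge v_i\}+\#\{k>i\mid v_k>v_i\}$, and put $\widetilde v=\overline{(-v_n,\dots,-v_1)}$.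 For a composition $\alpha\in\mathbb Z_{\ge0}^n$ put $|\alpha|=\alpha_1+\cdots+\alpha_n$ and $\mathrm I(\alpha)=\#\{i<j\mid \alpha_i\ge\alpha_j\}$. **Theorem A.** Let $\alpha\in\mathbb Z_{\ge0}^n$. There is a unique polynomial $G_\alpha=G_\alpha(x;q,t)\in\mathbb F[x]$ of degree at most $|\alpha|$ in which $x^\alpha$ has coefficient $1$ and such that $G_\alpha(\overline\beta)=0$ for all $\beta\in\mathbb Z_{\ge0}^n$ with $|\beta|\le|\alpha|$ and $\beta\ne\alpha$. There is a unique polynomial $G'_\alpha=G'_\alpha(x;q,t)\in\mathbb F[x]$ of degree at most $|\alpha|$ that has the same homogeneous part of degree $|\alpha|$ as $G_\alpha$ and satisfies $G'_\alpha(\widetilde\beta)=0$ for all $\beta\in\mathbb Z_{\ge0}^n$ with $|\beta|<|\alpha|$. They are related by $$G'_\alpha(x)=t^{(1-n)|\alpha|+\mathrm I(\alpha)}\,w_0H^\circ_{w_0}\,G^\circ_\alpha(t^{n-1}x)$$ and, equivalently, with $G'_\alpha(x;q^{-1},t^{-1})=(G'_\alpha)^\circ(x)$, $$G'_\alpha(t^{n-1}x;q^{-1},t^{-1})=t^{(n-1)|\alpha|-\mathrm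 I(\alpha)}\,w_0H_{w_0}\,G_\alpha(x;q,t).$$ -/

import Mathlib

noncomputable section

namespace InterpolationMacdonald

/-- The ground field `𝔽 = ℚ(q, t)` of rational functions in two indeterminates. -/
abbrev BaseField : Type := FractionRing (MvPolynomial (Fin 2) ℚ)

/-- The indeterminate `q` of `𝔽`. -/
def q : BaseField := algebraMap (MvPolynomial (Fin 2) ℚ) BaseField (MvPolynomial.X 0)

/-- The indeterminate `t` of `𝔽`. -/
def t : BaseField := algebraMap (MvPolynomial (Fin 2) ℚ) BaseField (MvPolynomial.X 1)

/-- Substitution of `q⁻¹` for `q` and `t⁻¹` for `t` in a polynomial in `q` and `t`. -/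
def invertHom : MvPolynomial (Fin 2) ℚ →ₐ[ℚ] BaseField := MvPolynomial.aeval ![q⁻¹, t⁻¹]

theorem q_ne_zero : q ≠ 0 := by
  simp [q]

theorem t_ne_zero : t ≠ 0 := by
  simp [t]

theorem invertHom_injective : Function.Injective invertHom := by
  rw [injective_iff_map_eq_zero]
  intro p hp
  set D : Fin 2 →₀ ℕ := p.support.sup id with hD
  have hle : ∀ m ∈ p.support, m ≤ D := fun m hm => Finset.le_sup (f := id) hm
  have key : algebraMap (MvPolynomial (Fin 2) ℚ) BaseField
      (∑ m ∈ p.support, MvPolynomial.monomial (D - m) (p.coeff m))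
      = invertHom p * (q ^ D 0 * t ^ D 1) := by
    conv_rhs => rw [p.as_sum]
    rw [map_sum, map_sum, Finset.sum_mul]
    refine Finset.sum_congr rfl fun m hm => ?_
    have h0 : D 0 = (D - m) 0 + m 0 := by
      have := hle m hm 0
      simp only [Finsupp.tsub_apply]; omega
    have h1 : D 1 = (D - m) 1 + m 1 := by
      have := hle m hm 1
      simp only [Finsupp.tsub_apply]; omega
    have hq := q_ne_zero
    have ht := t_ne_zero
    rw [h0, h1, invertHom, MvPolynomial.aeval_monomial, MvPolynomial.monomial_eq,
      Finsupp.prod_fintype _ _ (by simp), Finsupp.prod_fintype _ _ (by simp)]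
    have hc : algebraMap (MvPolynomial (Fin 2) ℚ) BaseField (MvPolynomial.C (p.coeff m))
        = algebraMap ℚ BaseField (p.coeff m) := by
      rw [IsScalarTower.algebraMap_apply ℚ (MvPolynomial (Fin 2) ℚ) BaseField]
      rfl
    simp only [Fin.prod_univ_two, map_mul, map_pow, hc, Matrix.cons_val_zero, Matrix.cons_val_one]
    change _ * (q ^ _ * t ^ _) = _
    have e0 : q ^ m 0 * q⁻¹ ^ m 0 = 1 := by rw [← mul_pow, mul_inv_cancel₀ hq, one_pow]
    have e1 : t ^ m 1 * t⁻¹ ^ m 1 = 1 := by rw [← mul_pow, mul_inv_cancel₀ ht, one_pow]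
    rw [pow_add, pow_add]
    set c := algebraMap ℚ BaseField (p.coeff m)
    calc c * (q ^ (D - m) 0 * t ^ (D - m) 1)
        = c * (q ^ (D - m) 0 * t ^ (D - m) 1) * (q ^ m 0 * q⁻¹ ^ m 0) * (t ^ m 1 * t⁻¹ ^ m 1) := by
          rw [e0, e1, mul_one, mul_one]
      _ = _ := by ring
  rw [hp, zero_mul, FaithfulSMul.algebraMap_eq_zero_iff] at key
  ext m
  by_cases hm : m ∈ p.support
  · have h := congrArg (MvPolynomial.coeff (D - m)) key
    rw [MvPolynomial.coeff_sum, Finset.sum_eq_single m] at h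
    · simpa using h
    · intro m' hm' hne
      rw [MvPolynomial.coeff_monomial, if_neg]
      intro he
      apply hne
      rw [← tsub_tsub_cancel_of_le (hle m' hm'), he, tsub_tsub_cancel_of_le (hle m hm)]
    · intro h'; exact absurd hm h'
  · simpa using hm

/-- The field endomorphism (in fact involution) `ι` of `𝔽` with `ι(q) = q⁻¹`, `ι(t) = t⁻¹`. -/
def iota : BaseField →+* BaseField :=
  IsFractionRing.lift (g := invertHom.toRingHom) invertHom_injective

theorem iota_q : iota q = q⁻¹ := by
  simp [iota, q, invertHom]

theorem iota_t : iota t = t⁻¹ := by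
  simp [iota, t, invertHom]

/-- `𝔽[x] = 𝔽[x₁, …, xₙ]`; the variable `x_i` has the index `i - 1` in `Fin n`. -/
abbrev PolyRing (n : ℕ) : Type := MvPolynomial (Fin n) BaseField

/-- `𝔽(x)`, the quotient field of `𝔽[x]`. -/
abbrev RatFun (n : ℕ) : Type := FractionRing (PolyRing n)

/-- The action of `ι` on the coefficients of a polynomial, `f ↦ f°`. -/
def circ {n : ℕ} (f : PolyRing n) : PolyRing n := MvPolynomial.map iota f

/-- The polynomial `f(c x) = f(c x₁, …, c xₙ)`. -/
def scale {n : ℕ} (c : BaseField) (f : PolyRing n) : PolyRing n :=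
  MvPolynomial.bind₁ (fun i => MvPolynomial.C c * MvPolynomial.X i) f

/-- `|α| = α₁ + ⋯ + αₙ`. -/
def size {n : ℕ} (α : Fin n → ℕ) : ℕ := ∑ i, α i

/-- `I(α) = #{i < j | α_i ≥ α_j}`. -/
def invCount {n : ℕ} (α : Fin n → ℕ) : ℕ :=
  (Finset.univ.filter fun p : Fin n × Fin n => p.1 < p.2 ∧ α p.2 ≤ α p.1).card

/-- `k_i(v) = #{k < i | v_k ≥ v_i} + #{k > i | v_k > v_i}`. -/
def kStat {n : ℕ} (v : Fin n → ℤ) (i : Fin n) : ℕ :=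
  (Finset.univ.filter fun k : Fin n => k < i ∧ v i ≤ v k).card +
    (Finset.univ.filter fun k : Fin n => i < k ∧ v i < v k).card

/-- The spectral vector `v̄ ∈ 𝔽ⁿ` of `v ∈ ℤⁿ`, with `v̄_i = q ^ v_i * t ^ (-k_i(v))`. -/
def bar {n : ℕ} (v : Fin n → ℤ) (i : Fin n) : BaseField :=
  q ^ v i * t ^ (-(kStat v i : ℤ))

/-- The point `ṽ`, which is the spectral vector of `-w₀ v = (-vₙ, …, -v₁)`. -/
def tilde {n : ℕ} (v : Fin n → ℤ) : Fin n → BaseField :=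
  bar fun i => -v i.rev

/-- `G` is the non-symmetric interpolation Macdonald polynomial `G_α = G_α(x; q, t)`: its degree
is at most `|α|`, it vanishes at `β̄` for all compositions `β ≠ α` with `|β| ≤ |α|`, and the
coefficient of `x^α` in it is `1`. -/
structure IsInterpolation {n : ℕ} (α : Fin n → ℕ) (G : PolyRing n) : Prop where
  degree_le : G.totalDegree ≤ size α
  vanishing : ∀ β : Fin n → ℕ, size β ≤ size α → β ≠ α →
    MvPolynomial.eval (bar fun i => (β i : ℤ)) G = 0
  coeff_eq_one : MvPolynomial.coeff (Finsupp.equivFunOnFinite.symm α) G = 1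

/-- `P` is the primed interpolation polynomial `G'_α = G'_α(x; q, t)`, where `G` is the polynomial
`G_α`: its degree is at most `|α|`, its homogeneous part of degree `|α|` is that of `G_α`, and it
vanishes at `β̃` for all compositions `β` with `|β| < |α|`. -/
structure IsPrimedInterpolation {n : ℕ} (α : Fin n → ℕ) (G P : PolyRing n) : Prop where
  degree_le : P.totalDegree ≤ size α
  top_eq : MvPolynomial.homogeneousComponent (size α) P =
    MvPolynomial.homogeneousComponent (size α) G
  vanishing : ∀ β : Fin n → ℕ, size β < size α →
    MvPolynomial.eval (tilde fun i => (β i : ℤ)) P = 0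

/-- The action of `w ∈ Sₙ` on `𝔽(x)`: the field automorphism over `𝔽` with `x_i ↦ x_{w(i)}`. -/
def permute {n : ℕ} (w : Equiv.Perm (Fin n)) : RatFun n →ₐ[BaseField] RatFun n :=
  IsFractionRing.liftAlgHom (R := BaseField)
    (g := (IsScalarTower.toAlgHom BaseField (PolyRing n) (RatFun n)).comp
      (MvPolynomial.renameEquiv BaseField w : PolyRing n →ₐ[BaseField] PolyRing n))
    ((IsFractionRing.injective (PolyRing n) (RatFun n)).comp
      (MvPolynomial.renameEquiv BaseField w).injective)

/-- The element `x_i` of `𝔽(x)`. -/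
def x {n : ℕ} (i : Fin n) : RatFun n := algebraMap (PolyRing n) (RatFun n) (MvPolynomial.X i)

/-- The position `i` (with `0 ≤ i < n - 1`) in `Fin n`. -/
def lo {n : ℕ} (i : Fin (n - 1)) : Fin n := ⟨i, by omega⟩

/-- The position `i + 1` (with `0 ≤ i < n - 1`) in `Fin n`. -/
def hi {n : ℕ} (i : Fin (n - 1)) : Fin n := ⟨i + 1, by omega⟩

/-- The simple transposition `s_i` that swaps the neighbours `i` and `i + 1`. -/
def simple {n : ℕ} (i : Fin (n - 1)) : Equiv.Perm (Fin n) := Equiv.swap (lo i) (hi i)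

/-- The Demazure–Lusztig operator with parameter `s` on `𝔽(x)`,
`f ↦ s • s_i f - ((1 - s) x_i / (x_i - x_{i+1})) (f - s_i f)`.
It is `H_i` for `s = t` and `H_i°` for `s = t⁻¹`. -/
def demazureLusztig {n : ℕ} (s : BaseField) (i : Fin (n - 1)) :
    Module.End BaseField (RatFun n) :=
  s • (permute (simple i)).toLinearMap -
    LinearMap.mulLeft BaseField
      ((algebraMap BaseField (RatFun n) (1 - s) * x (lo i)) / (x (lo i) - x (hi i))) *
      (1 - (permute (simple i)).toLinearMap)

/-- The word `l = [i₁, …, i_ℓ]` is a reduced expression of `w`, that is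
`w = s_{i₁} ⋯ s_{i_ℓ}` and no shorter word in the simple transpositions has this product. -/
def IsReducedWord {n : ℕ} (l : List (Fin (n - 1))) (w : Equiv.Perm (Fin n)) : Prop :=
  (l.map simple).prod = w ∧
    ∀ l' : List (Fin (n - 1)), (l'.map simple).prod = w → l.length ≤ l'.length

theorem exists_isReducedWord {n : ℕ} (w : Equiv.Perm (Fin n)) :
    ∃ l : List (Fin (n - 1)), IsReducedWord l w := by
  have hw : ∃ l : List (Fin (n - 1)), (l.map simple).prod = w := by
    rcases n with _ | n
    · exact ⟨[], Subsingleton.elim _ _⟩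
    · have h : w ∈ Submonoid.closure
          (Set.range fun i : Fin n => Equiv.swap i.castSucc i.succ) := by
        rw [Equiv.Perm.mclosure_swap_castSucc_succ]; trivial
      induction h using Submonoid.closure_induction with
      | mem y hy =>
        obtain ⟨i, rfl⟩ := hy
        exact ⟨[i], by simp [simple]; rfl⟩
      | one => exact ⟨[], rfl⟩
      | mul y z _ _ hy hz =>
        obtain ⟨l, hl⟩ := hy
        obtain ⟨l', hl'⟩ := hz
        exact ⟨l ++ l', by rw [List.map_append, List.prod_append, hl, hl']⟩
  have hk : ∃ k : ℕ, ∃ l : List (Fin (n - 1)), (l.map simple).prod = w ∧ l.length = k :=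
    hw.elim fun l hl => ⟨_, l, hl, rfl⟩
  classical
  obtain ⟨l, hl, hlen⟩ := Nat.find_spec hk
  exact ⟨l, hl, fun l' hl' => hlen ▸ Nat.find_min' hk ⟨l', hl', rfl⟩⟩

/-- The operator product `H_{i₁} ⋯ H_{i_ℓ}` with parameter `s`, for the word `l = [i₁, …, i_ℓ]`.
When `l` is a reduced expression of `w`, it is `H_w` for `s = t` and `H_w°` for `s = t⁻¹`. -/
def heckeWord {n : ℕ} (s : BaseField) (l : List (Fin (n - 1))) :
    Module.End BaseField (RatFun n) :=
  (l.map (demazureLusztig s)).prod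

/-- The longest element `w₀` of `Sₙ`, `i ↦ n + 1 - i` for `1 ≤ i ≤ n`. -/
def longest (n : ℕ) : Equiv.Perm (Fin n) := Fin.revPerm

end InterpolationMacdonald

end

open InterpolationMacdonald

/-!
The existence of `G_α` is proved by induction along two moves. If `α_i < α_(i+1)`, adding a
suitable multiple of the identity to `H_i` turns `G_α` into `G_(s_i α)`; the operator `raise` turns
it into a multiple of `G_(α_2, …, α_n, α_1 + 1)`. Both preserve the vanishing because they relate
values at the points `β̄` through the corresponding moves of compositions, and starting from
`α = 0` they reach every composition. The coefficient of `x^α` is under control because the top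
homogeneous part `E` of `G_α` is triangular for an order on compositions. Uniqueness holds because
a polynomial of degree less than `d` that vanishes at `β̄` for all `|β| < d` is zero.

The relation with `G'_α` comes down to the symmetry `w_0 H_(w_0) E = t^I(α) E°`. The move through
`H_i` preserves it since `H_(w_0)` conjugates `H_i` to `H_(n-i)`. For `raise` one needs the
eigenvalue equation `G_α + H_1 ⋯ H_(n-1) (raise G_α) = (x_1 / ᾱ_1) G_α`: the left side is divisible
by `x_1`, and the quotient has the degree bound and the zeros that determine `G_α` up to a scalar.
Its top part is combined with the symmetry of `E` through the two factorizations
`H_(w_0) = H_(w_0') H_(n-1) ⋯ H_1 = H_(w_0'') H_1 ⋯ H_(n-1)`, where `w_0'` and `w_0''` are the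
longest elements on the first and on the last `n - 1` variables.

With the symmetry, `t^((n-1)|α| - I(α)) w_0 H_(w_0) G_α` and `E°(t^(n-1) x)` have the same part of
degree `|α|`, and the operators `H_i` preserve vanishing at all `β̄` with `|β| < |α|`; so
`f ↦ f°(t^(n-1) x)` takes the former to `G'_α`.
-/

noncomputable section

namespace InterpolationMacdonald

open MvPolynomial

section Words

variable {n : ℕ}

theorem simple_lo (i : Fin (n - 1)) : simple i (lo i) = hi i :=
  Equiv.swap_apply_left _ _

theorem simple_hi (i : Fin (n - 1)) : simple i (hi i) = lo i :=
  Equiv.swap_apply_right _ _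

theorem simple_of_ne {i : Fin (n - 1)} {k : Fin n} (hlo : k ≠ lo i) (hhi : k ≠ hi i) :
    simple i k = k :=
  Equiv.swap_apply_of_ne_of_ne hlo hhi

theorem simple_simple (i : Fin (n - 1)) (k : Fin n) : simple i (simple i k) = k :=
  Equiv.swap_apply_self _ _ _

theorem simple_mul_self (i : Fin (n - 1)) : simple i * simple i = 1 :=
  Equiv.swap_mul_self _ _

theorem mul_simple_mul_simple (w : Equiv.Perm (Fin n)) (i : Fin (n - 1)) :
    w * simple i * simple i = w := by
  rw [mul_assoc, simple_mul_self, mul_one]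

theorem comp_simple_comp_simple {A : Type*} (α : Fin n → A) (i : Fin (n - 1)) :
    (α ∘ simple i) ∘ simple i = α := by
  funext k
  exact congrArg α (simple_simple i k)

theorem lo_lt_hi (i : Fin (n - 1)) : lo i < hi i :=
  Nat.lt_succ_self _

theorem lo_ne_hi (i : Fin (n - 1)) : lo i ≠ hi i :=
  (lo_lt_hi i).ne

theorem lo_eq_hi {i j : Fin (n - 1)} (h : (i : ℕ) + 1 = j) : lo j = hi i :=
  Fin.ext h.symm

theorem lo_ne_hi_of_le {i j : Fin (n - 1)} (h : (i : ℕ) ≤ j) : lo i ≠ hi j :=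
  fun e => absurd (congrArg Fin.val e) (by simp only [lo, hi]; omega)

theorem simple_apply_of_far {i j : Fin (n - 1)} (h : (i : ℕ) + 1 < j ∨ (j : ℕ) + 1 < i) :
    simple i (lo j) = lo j ∧ simple i (hi j) = hi j := by
  constructor <;> refine simple_of_ne ?_ ?_ <;> simp only [lo, hi, ne_eq, Fin.ext_iff] <;> omega

theorem simple_lt_simple {i : Fin (n - 1)} {p k : Fin n} (h : p < k)
    (hne : ¬ (p = lo i ∧ k = hi i)) : simple i p < simple i k := by
  simp only [simple, Equiv.swap_apply_def, lo, hi, Fin.ext_iff, Fin.lt_def] at *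
  split_ifs <;> (try dsimp only) <;> omega

theorem simple_mul_simple_comm {i j : Fin (n - 1)} (h : (i : ℕ) + 1 < j) :
    simple i * simple j = simple j * simple i := by
  obtain ⟨hlo, hhi⟩ := simple_apply_of_far (.inl h)
  rw [simple, simple, Equiv.mul_swap_eq_swap_mul, ← simple, hlo, hhi]

theorem swap_braid {ι : Type*} [DecidableEq ι] {a b c : ι} (hab : a ≠ b) (hac : a ≠ c)
    (hbc : b ≠ c) : Equiv.swap a b * (Equiv.swap b c * Equiv.swap a b) =
      Equiv.swap b c * (Equiv.swap a b * Equiv.swap b c) := by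
  rw [← mul_assoc, ← mul_assoc, Equiv.swap_mul_swap_mul_swap hab hac, Equiv.swap_comm a b,
    Equiv.swap_comm b c, Equiv.swap_mul_swap_mul_swap hbc.symm hac.symm, Equiv.swap_comm]

theorem simple_braid {i j : Fin (n - 1)} (h : (i : ℕ) + 1 = j) :
    simple i * simple j * simple i = simple j * simple i * simple j := by
  have hbc := lo_ne_hi j
  rw [lo_eq_hi h] at hbc
  simpa only [mul_assoc, simple, lo_eq_hi h] using
    swap_braid (lo_ne_hi i) (lo_ne_hi_of_le (by omega)) hbc

theorem monotone_of_lo_le_hi {A : Type*} [Preorder A] {α : Fin n → A}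
    (h : ∀ i, α (lo i) ≤ α (hi i)) : Monotone α := by
  rcases n with _ | n
  · exact fun i => i.elim0
  · exact Fin.monotone_iff_le_succ.2 h

theorem size_comp (α : Fin n → ℕ) (w : Equiv.Perm (Fin n)) : size (α ∘ w) = size α :=
  Equiv.sum_comp w α

theorem invCount_comp_simple {α : Fin n → ℕ} {i : Fin (n - 1)} (h : α (lo i) < α (hi i)) :
    invCount (α ∘ simple i) = invCount α + 1 := by
  have hmem : (lo i, hi i) ∈ Finset.univ.filter fun p : Fin n × Fin n =>
      p.1 < p.2 ∧ (α ∘ simple i) p.2 ≤ (α ∘ simple i) p.1 := by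
    simp [lo_lt_hi, h.le, simple_lo, simple_hi]
  rw [invCount, invCount, ← Finset.card_erase_add_one hmem, Nat.add_right_cancel_iff]
  refine Finset.card_nbij' (Prod.map (simple i) (simple i)) (Prod.map (simple i) (simple i))
    ?_ ?_ (fun _ _ => Prod.ext (simple_simple i _) (simple_simple i _))
    (fun _ _ => Prod.ext (simple_simple i _) (simple_simple i _))
  · rintro ⟨p, k⟩ hp
    simp only [Finset.coe_erase, Finset.coe_filter, Finset.mem_univ, true_and, Set.mem_sdiff,
      Set.mem_ofPred_eq, Set.mem_singleton_iff, Prod.mk.injEq, Function.comp_apply,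
      Prod.map_apply] at hp ⊢
    exact ⟨simple_lt_simple hp.1.1 hp.2, hp.1.2⟩
  · rintro ⟨p, k⟩ hp
    simp only [Finset.coe_erase, Finset.coe_filter, Finset.mem_univ, true_and, Set.mem_sdiff,
      Set.mem_ofPred_eq, Set.mem_singleton_iff, Prod.mk.injEq, Function.comp_apply,
      Prod.map_apply, simple_simple] at hp ⊢
    have hne : ¬ (p = lo i ∧ k = hi i) := by
      rintro ⟨rfl, rfl⟩
      exact h.not_ge hp.2
    refine ⟨⟨simple_lt_simple hp.1 hne, hp.2⟩, ?_⟩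
    rintro ⟨hplo, hkhi⟩
    rw [← simple_simple i p, ← simple_simple i k, hplo, hkhi, simple_lo, simple_hi] at hp
    exact (lo_lt_hi i).not_gt hp.1

theorem invCount_comp_simple_add_one {α : Fin n → ℕ} {i : Fin (n - 1)}
    (h : α (hi i) < α (lo i)) : invCount (α ∘ simple i) + 1 = invCount α := by
  have key := invCount_comp_simple (α := α ∘ simple i) (i := i)
    (by simpa only [Function.comp_apply, simple_lo, simple_hi] using h)
  rwa [comp_simple_comp_simple, eq_comm] at key

theorem invCount_cons (a : ℕ) (α : Fin n → ℕ) :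
    invCount (Fin.cons a α : Fin (n + 1) → ℕ) =
      (Finset.univ.filter fun j => α j ≤ a).card + invCount α := by
  simp only [invCount, Finset.card_filter, Fintype.sum_prod_type, Fin.sum_univ_succ,
    Fin.cons_zero, Fin.cons_succ]
  simp

theorem invCount_snoc (a : ℕ) (α : Fin n → ℕ) :
    invCount (Fin.snoc α a : Fin (n + 1) → ℕ) =
      (Finset.univ.filter fun j => a ≤ α j).card + invCount α := by
  simp only [invCount, Finset.card_filter, Fintype.sum_prod_type, Fin.sum_univ_castSucc,
    Fin.snoc_castSucc, Fin.snoc_last, Finset.sum_add_distrib]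
  simp [Fin.castSucc_lt_last, add_comm, (Fin.castSucc_lt_last _).not_gt]

/-- The number of inversions of a permutation; it is its Coxeter length. -/
def inversions (w : Equiv.Perm (Fin n)) : ℕ := invCount fun i => (w i : ℕ)

/-- `i` is a right descent of `w`, so that `w s_i` is shorter than `w`. -/
def IsDescent (w : Equiv.Perm (Fin n)) (i : Fin (n - 1)) : Prop := w (hi i) < w (lo i)

theorem inversions_mul_simple_of_lt {w : Equiv.Perm (Fin n)} {i : Fin (n - 1)}
    (h : w (lo i) < w (hi i)) : inversions (w * simple i) = inversions w + 1 :=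
  invCount_comp_simple (α := fun i => (w i : ℕ)) h

theorem IsDescent.inversions_mul_simple {w : Equiv.Perm (Fin n)} {i : Fin (n - 1)}
    (h : IsDescent w i) : inversions (w * simple i) + 1 = inversions w :=
  invCount_comp_simple_add_one (α := fun i => (w i : ℕ)) h

theorem lt_or_isDescent (w : Equiv.Perm (Fin n)) (i : Fin (n - 1)) :
    w (lo i) < w (hi i) ∨ IsDescent w i :=
  lt_or_gt_of_ne (w.injective.ne (lo_ne_hi i))

theorem inversions_one : inversions (1 : Equiv.Perm (Fin n)) = 0 := by
  simp only [inversions, invCount, Finset.card_eq_zero, Finset.filter_eq_empty_iff]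
  rintro ⟨p, k⟩ _ ⟨hlt, hle⟩
  exact hlt.not_ge hle

theorem eq_one_of_monotone {w : Equiv.Perm (Fin n)} (h : Monotone w) : w = 1 := by
  have hw : StrictMono w := h.strictMono_of_injective w.injective
  have hrefl : hw.orderIsoOfSurjective w w.surjective = OrderIso.refl _ := Subsingleton.elim _ _
  exact Equiv.ext fun i => DFunLike.congr_fun hrefl i

theorem exists_isDescent {w : Equiv.Perm (Fin n)} (h : w ≠ 1) : ∃ i, IsDescent w i := by
  contrapose! h
  exact eq_one_of_monotone (monotone_of_lo_le_hi fun i => not_lt.1 (h i))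

/-- The permutation `s_{i₁} ⋯ s_{i_ℓ}` given by a word `[i₁, …, i_ℓ]`. -/
def wordPerm (l : List (Fin (n - 1))) : Equiv.Perm (Fin n) := (l.map simple).prod

@[simp] theorem wordPerm_nil : wordPerm ([] : List (Fin (n - 1))) = 1 := rfl

@[simp] theorem wordPerm_cons (i : Fin (n - 1)) (l : List (Fin (n - 1))) :
    wordPerm (i :: l) = simple i * wordPerm l := rfl

@[simp] theorem wordPerm_append (l l' : List (Fin (n - 1))) :
    wordPerm (l ++ l') = wordPerm l * wordPerm l' := by
  simp only [wordPerm, List.map_append, List.prod_append]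

theorem wordPerm_append_singleton (l : List (Fin (n - 1))) (i : Fin (n - 1)) :
    wordPerm (l ++ [i]) = wordPerm l * simple i := by
  rw [wordPerm_append, wordPerm_cons, wordPerm_nil, mul_one]

theorem wordPerm_reverse (l : List (Fin (n - 1))) : wordPerm l.reverse = (wordPerm l)⁻¹ := by
  induction l with
  | nil => exact inv_one.symm
  | cons i l ih =>
    rw [List.reverse_cons, wordPerm_append_singleton, ih, wordPerm_cons, mul_inv_rev, simple,
      Equiv.swap_inv]

theorem inversions_wordPerm_le (l : List (Fin (n - 1))) : inversions (wordPerm l) ≤ l.length := by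
  induction l using List.reverseRecOn with
  | nil => exact inversions_one.le
  | append_singleton l i ih =>
    rw [wordPerm_append_singleton, List.length_append, List.length_singleton]
    rcases lt_or_isDescent (wordPerm l) i with h | h
    · rw [inversions_mul_simple_of_lt h]
      omega
    · have := h.inversions_mul_simple
      omega

theorem exists_wordPerm_eq_and_length_eq (w : Equiv.Perm (Fin n)) :
    ∃ l, wordPerm l = w ∧ l.length = inversions w := by
  induction h : inversions w using Nat.strong_induction_on generalizing w with
  | _ k ih =>
    by_cases hw : w = 1
    · exact ⟨[], hw.symm, by rw [← h, hw, inversions_one, List.length_nil]⟩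
    · obtain ⟨i, hi⟩ := exists_isDescent hw
      have hlt := hi.inversions_mul_simple
      obtain ⟨l, hl, hlen⟩ := ih _ (by omega) (w * simple i) rfl
      refine ⟨l ++ [i], ?_, ?_⟩
      · rw [wordPerm_append_singleton, hl, mul_simple_mul_simple]
      · rw [List.length_append, List.length_singleton]
        omega

theorem isReducedWord_iff {l : List (Fin (n - 1))} {w : Equiv.Perm (Fin n)} :
    IsReducedWord l w ↔ wordPerm l = w ∧ l.length = inversions w := by
  refine and_congr_right fun hl => ⟨fun hmin => le_antisymm ?_ ?_, fun hlen l' hl' => ?_⟩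
  · obtain ⟨l', hl', hlen⟩ := exists_wordPerm_eq_and_length_eq w
    exact hlen ▸ hmin l' hl'
  · exact hl ▸ inversions_wordPerm_le l
  · exact hlen.trans_le (hl' ▸ inversions_wordPerm_le l')

theorem IsDescent.isReducedWord_append {w : Equiv.Perm (Fin n)} {i : Fin (n - 1)}
    (h : IsDescent w i) {l : List (Fin (n - 1))} (hl : IsReducedWord l (w * simple i)) :
    IsReducedWord (l ++ [i]) w := by
  rw [isReducedWord_iff] at hl ⊢
  rw [wordPerm_append_singleton, hl.1, mul_simple_mul_simple, List.length_append, hl.2]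
  exact ⟨rfl, h.inversions_mul_simple⟩

theorem IsReducedWord.of_append {w : Equiv.Perm (Fin n)} {i : Fin (n - 1)}
    {l : List (Fin (n - 1))} (h : IsReducedWord (l ++ [i]) w) :
    IsDescent w i ∧ IsReducedWord l (w * simple i) := by
  rw [isReducedWord_iff, wordPerm_append_singleton, List.length_append,
    List.length_singleton] at h
  have hl : wordPerm l = w * simple i := by rw [← h.1, mul_simple_mul_simple]
  have hle := inversions_wordPerm_le l
  rw [hl] at hle
  rcases lt_or_isDescent w i with hlt | hd
  · rw [inversions_mul_simple_of_lt hlt] at hle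
    omega
  · have := hd.inversions_mul_simple
    exact ⟨hd, isReducedWord_iff.2 ⟨hl, by omega⟩⟩

theorem isDescent_mul_simple_of_far {w : Equiv.Perm (Fin n)} {i j : Fin (n - 1)}
    (h : (i : ℕ) + 1 < j ∨ (j : ℕ) + 1 < i) : IsDescent (w * simple i) j ↔ IsDescent w j := by
  obtain ⟨hlo, hhi⟩ := simple_apply_of_far h
  rw [IsDescent, Equiv.Perm.mul_apply, Equiv.Perm.mul_apply, hlo, hhi, IsDescent]

/-- Elements `T_i` of a monoid, indexed by the simple transpositions, that satisfy the braid
relations. -/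
structure IsBraidFamily {M : Type*} [Monoid M] (T : Fin (n - 1) → M) : Prop where
  comm : ∀ i j : Fin (n - 1), (i : ℕ) + 1 < j → T i * T j = T j * T i
  braid : ∀ i j : Fin (n - 1), (i : ℕ) + 1 = j → T i * T j * T i = T j * T i * T j

namespace IsBraidFamily

variable {M : Type*} [Monoid M] {T : Fin (n - 1) → M} {w : Equiv.Perm (Fin n)}

theorem exists_isReducedWord_pair_of_far (hT : IsBraidFamily T) {i j : Fin (n - 1)}
    (hij : (i : ℕ) + 1 < j) (hi : IsDescent w i) (hj : IsDescent w j) :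
    ∃ u v, IsReducedWord u (w * simple i) ∧ IsReducedWord v (w * simple j) ∧
      (u.map T).prod * T i = (v.map T).prod * T j := by
  obtain ⟨z, hz⟩ := exists_isReducedWord (w * simple i * simple j)
  have hz' := hz
  rw [mul_assoc, simple_mul_simple_comm hij, ← mul_assoc] at hz'
  refine ⟨z ++ [j], z ++ [i],
    ((isDescent_mul_simple_of_far (.inl hij)).2 hj).isReducedWord_append hz,
    ((isDescent_mul_simple_of_far (.inr hij)).2 hi).isReducedWord_append hz', ?_⟩
  simp only [List.map_append, List.prod_append, List.map_singleton, List.prod_singleton,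
    mul_assoc, hT.comm i j hij]

theorem exists_isReducedWord_pair_of_adjacent (hT : IsBraidFamily T) {i j : Fin (n - 1)}
    (hij : (i : ℕ) + 1 = j) (hi : IsDescent w i) (hj : IsDescent w j) :
    ∃ u v, IsReducedWord u (w * simple i) ∧ IsReducedWord v (w * simple j) ∧
      (u.map T).prod * T i = (v.map T).prod * T j := by
  obtain ⟨z, hz⟩ := exists_isReducedWord (w * simple i * simple j * simple i)
  have hz' : IsReducedWord z (w * simple j * simple i * simple j) := by
    simpa only [mul_assoc, ← simple_braid hij] using hz
  have hmid := lo_eq_hi hij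
  have hne : lo i ≠ InterpolationMacdonald.hi j := lo_ne_hi_of_le (by omega)
  have hfix : simple j (lo i) = lo i := simple_of_ne (hmid ▸ lo_ne_hi i) hne
  have hfix' : simple i (InterpolationMacdonald.hi j) = InterpolationMacdonald.hi j :=
    simple_of_ne hne.symm (hmid ▸ (lo_ne_hi j).symm)
  have hdesc : w (InterpolationMacdonald.hi j) < w (lo i) :=
    (show w (InterpolationMacdonald.hi j) < w (InterpolationMacdonald.hi i) from hmid ▸ hj).trans hi
  have hi₁ : IsDescent (w * simple i) j := by
    simpa only [IsDescent, Equiv.Perm.mul_apply, hfix', hmid, simple_hi] using hdesc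
  have hj₁ : IsDescent (w * simple j) i := by
    simpa only [IsDescent, Equiv.Perm.mul_apply, hfix, ← hmid, simple_lo] using hdesc
  have hi₂ : IsDescent (w * simple i * simple j) i := by
    simpa only [IsDescent, Equiv.Perm.mul_apply, hfix, hfix', ← hmid, simple_lo, hmid ▸ simple_lo i]
      using hj
  have hj₂ : IsDescent (w * simple j * simple i) j := by
    simpa only [IsDescent, Equiv.Perm.mul_apply, hfix, hfix', hmid, simple_hi, hmid ▸ simple_hi j]
      using hi
  refine ⟨z ++ [i] ++ [j], z ++ [j] ++ [i],
    hi₁.isReducedWord_append (hi₂.isReducedWord_append hz),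
    hj₁.isReducedWord_append (hj₂.isReducedWord_append hz'), ?_⟩
  simp only [List.map_append, List.prod_append, List.map_singleton, List.prod_singleton]
  simpa only [mul_assoc] using congrArg ((z.map T).prod * ·) (hT.braid i j hij)

theorem exists_isReducedWord_pair (hT : IsBraidFamily T) {i j : Fin (n - 1)} (hij : i < j)
    (hi : IsDescent w i) (hj : IsDescent w j) :
    ∃ u v, IsReducedWord u (w * simple i) ∧ IsReducedWord v (w * simple j) ∧
      (u.map T).prod * T i = (v.map T).prod * T j := by
  rcases (Nat.succ_le_of_lt hij).eq_or_lt with hadj | hfar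
  · exact hT.exists_isReducedWord_pair_of_adjacent hadj hi hj
  · exact hT.exists_isReducedWord_pair_of_far hfar hi hj

/-- Matsumoto's theorem for the symmetric group. -/
theorem prod_map_eq (hT : IsBraidFamily T) {l l' : List (Fin (n - 1))}
    (hl : IsReducedWord l w) (hl' : IsReducedWord l' w) :
    (l.map T).prod = (l'.map T).prod := by
  induction hk : inversions w generalizing w l l' with
  | zero =>
    rw [List.length_eq_zero_iff.1 ((isReducedWord_iff.1 hl).2.trans hk),
      List.length_eq_zero_iff.1 ((isReducedWord_iff.1 hl').2.trans hk)]
  | succ k ih =>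
    have exists_last : ∀ {l}, IsReducedWord l w → ∃ m i, l = m ++ [i] := fun {l} h =>
      l.eq_nil_or_concat'.resolve_left (by rintro rfl; simpa [hk] using (isReducedWord_iff.1 h).2)
    have inversions_eq : ∀ {i}, IsDescent w i → inversions (w * simple i) = k := fun h =>
      Nat.succ.inj (h.inversions_mul_simple.trans hk)
    obtain ⟨m, i, rfl⟩ := exists_last hl
    obtain ⟨m', j, rfl⟩ := exists_last hl'
    obtain ⟨hi, hmi⟩ := hl.of_append
    obtain ⟨hj, hmj⟩ := hl'.of_append
    simp only [List.map_append, List.prod_append, List.map_singleton, List.prod_singleton]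
    rcases lt_trichotomy i j with hij | rfl | hij
    · obtain ⟨u, v, hu, hv, huv⟩ := hT.exists_isReducedWord_pair hij hi hj
      rw [ih hmi hu (inversions_eq hi), huv, ih hmj hv (inversions_eq hj)]
    · rw [ih hmi hmj (inversions_eq hi)]
    · obtain ⟨u, v, hu, hv, huv⟩ := hT.exists_isReducedWord_pair hij hj hi
      rw [ih hmi hv (inversions_eq hi), ← huv, ih hmj hu (inversions_eq hj)]

end IsBraidFamily

theorem longest_apply (k : Fin n) : longest n k = k.rev := rfl

theorem rev_lo (i : Fin (n - 1)) : (lo i).rev = hi i.rev := by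
  simp only [lo, hi, Fin.ext_iff, Fin.val_rev]
  omega

theorem rev_hi (i : Fin (n - 1)) : (hi i).rev = lo i.rev := by
  rw [Fin.rev_eq_iff, rev_lo, Fin.rev_rev]

theorem longest_mul_simple (i : Fin (n - 1)) :
    longest n * simple i = simple i.rev * longest n := by
  rw [simple, simple, Equiv.mul_swap_eq_swap_mul, longest_apply, longest_apply, rev_lo, rev_hi,
    Equiv.swap_comm]

theorem isDescent_longest (i : Fin (n - 1)) : IsDescent (longest n) i :=
  Fin.rev_lt_rev.2 (lo_lt_hi i)

theorem inversions_longest : inversions (longest n) = invCount (fun _ : Fin n => 0) := by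
  refine congrArg Finset.card (Finset.filter_congr fun p _ => ?_)
  simp only [longest_apply, Fin.val_fin_le, Fin.rev_le_rev, le_refl, and_true,
    and_iff_left_iff_imp]
  exact le_of_lt

theorem inversions_longest_succ : inversions (longest (n + 1)) = inversions (longest n) + n := by
  have hcons : (fun _ : Fin (n + 1) => 0) = (Fin.cons 0 fun _ => 0 : Fin (n + 1) → ℕ) :=
    (Fin.cons_self_tail _).symm
  rw [inversions_longest, inversions_longest, hcons, invCount_cons]
  simp [add_comm]

theorem IsBraidFamily.prod_map_longest_mul {M : Type*} [Monoid M] {T : Fin (n - 1) → M}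
    (hT : IsBraidFamily T) {l : List (Fin (n - 1))} (hl : IsReducedWord l (longest n))
    (i : Fin (n - 1)) : (l.map T).prod * T i = T i.rev * (l.map T).prod := by
  obtain ⟨m, hm⟩ := exists_isReducedWord (longest n * simple i)
  have happend : IsReducedWord (m ++ [i]) (longest n) :=
    (isDescent_longest i).isReducedWord_append hm
  have hcons : IsReducedWord (i.rev :: m) (longest n) := by
    rw [isReducedWord_iff] at hm ⊢
    rw [wordPerm_cons, hm.1, longest_mul_simple, ← mul_assoc, simple_mul_self, one_mul,
      List.length_cons, hm.2]
    exact ⟨rfl, (isDescent_longest i).inversions_mul_simple⟩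
  calc (l.map T).prod * T i = ((i.rev :: m).map T).prod * T i := by rw [hT.prod_map_eq hl hcons]
    _ = T i.rev * ((m ++ [i]).map T).prod := by simp [mul_assoc]
    _ = T i.rev * (l.map T).prod := by rw [hT.prod_map_eq hl happend]

end Words

section LongestWords

variable {n : ℕ}

/-- The same word in the simple transpositions of `Sₙ₊₁` that fix the last point. -/
def castSuccWord (l : List (Fin (n - 1))) : List (Fin (n + 1 - 1)) := l.map lo

/-- The word shifted to the simple transpositions of `Sₙ₊₁` that fix the first point. -/
def succWord (l : List (Fin (n - 1))) : List (Fin (n + 1 - 1)) := l.map hi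

/-- The word `[1, …, n]` of the long cycle of `Sₙ₊₁`. -/
def cycleWord (n : ℕ) : List (Fin (n + 1 - 1)) := List.finRange n

theorem simple_lo_castSucc (i : Fin (n - 1)) (k : Fin n) :
    simple (n := n + 1) (lo i) k.castSucc = (simple i k).castSucc :=
  ((Fin.castSucc_injective n).map_swap (lo i) (hi i) k).symm

theorem simple_lo_last (i : Fin (n - 1)) :
    simple (n := n + 1) (lo i) (Fin.last n) = Fin.last n :=
  simple_of_ne (Fin.castSucc_lt_last (lo i)).ne' (Fin.castSucc_lt_last (hi i)).ne'

theorem simple_hi_succ (i : Fin (n - 1)) (k : Fin n) :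
    simple (n := n + 1) (hi i) k.succ = (simple i k).succ :=
  ((Fin.succ_injective n).map_swap (lo i) (hi i) k).symm

theorem simple_hi_zero (i : Fin (n - 1)) : simple (n := n + 1) (hi i) 0 = 0 :=
  simple_of_ne (Fin.succ_ne_zero (lo i)).symm (Fin.succ_ne_zero (hi i)).symm

theorem wordPerm_castSuccWord_castSucc (l : List (Fin (n - 1))) (k : Fin n) :
    wordPerm (castSuccWord l) k.castSucc = (wordPerm l k).castSucc := by
  induction l with
  | nil => rfl
  | cons i l ih =>
    exact (congrArg (simple (n := n + 1) (lo i)) ih).trans (simple_lo_castSucc i _)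

theorem wordPerm_castSuccWord_last (l : List (Fin (n - 1))) :
    wordPerm (castSuccWord l) (Fin.last n) = Fin.last n := by
  induction l with
  | nil => rfl
  | cons i l ih => exact (congrArg (simple (n := n + 1) (lo i)) ih).trans (simple_lo_last i)

theorem wordPerm_succWord_succ (l : List (Fin (n - 1))) (k : Fin n) :
    wordPerm (succWord l) k.succ = (wordPerm l k).succ := by
  induction l with
  | nil => rfl
  | cons i l ih => exact (congrArg (simple (n := n + 1) (hi i)) ih).trans (simple_hi_succ i _)

theorem wordPerm_succWord_zero (l : List (Fin (n - 1))) : wordPerm (succWord l) 0 = 0 := by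
  induction l with
  | nil => rfl
  | cons i l ih => exact (congrArg (simple (n := n + 1) (hi i)) ih).trans (simple_hi_zero i)

theorem cycleWord_succ (n : ℕ) :
    cycleWord (n + 1) = (0 : Fin (n + 1)) :: succWord (n := n + 1) (cycleWord n) :=
  List.finRange_succ

theorem wordPerm_cycleWord_last (n : ℕ) : wordPerm (cycleWord n) (Fin.last n) = 0 := by
  induction n with
  | zero => rfl
  | succ n ih =>
    rw [cycleWord_succ, wordPerm_cons, Equiv.Perm.mul_apply, ← Fin.succ_last,
      wordPerm_succWord_succ, ih]
    exact simple_hi (n := n + 2) (0 : Fin (n + 1))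

theorem wordPerm_cycleWord_castSucc (k : Fin n) :
    wordPerm (cycleWord n) k.castSucc = k.succ := by
  induction n with
  | zero => exact k.elim0
  | succ n ih =>
    rw [cycleWord_succ, wordPerm_cons, Equiv.Perm.mul_apply]
    cases k using Fin.cases with
    | zero =>
      rw [Fin.castSucc_zero, wordPerm_succWord_zero]
      exact simple_lo (n := n + 2) (0 : Fin (n + 1))
    | succ k =>
      rw [← Fin.succ_castSucc, wordPerm_succWord_succ, ih]
      exact simple_of_ne (Fin.succ_ne_zero _)
        ((Fin.succ_injective _).ne (Fin.succ_ne_zero _))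

theorem IsReducedWord.castSuccWord_append {l : List (Fin (n - 1))}
    (h : IsReducedWord l (longest n)) :
    IsReducedWord (castSuccWord l ++ (cycleWord n).reverse) (longest (n + 1)) := by
  rw [isReducedWord_iff] at h ⊢
  constructor
  · rw [wordPerm_append, wordPerm_reverse, mul_inv_eq_iff_eq_mul]
    ext k
    cases k using Fin.lastCases with
    | last =>
      rw [wordPerm_castSuccWord_last, Equiv.Perm.mul_apply, wordPerm_cycleWord_last,
        longest_apply, Fin.rev_zero]
    | cast k =>
      rw [wordPerm_castSuccWord_castSucc, Equiv.Perm.mul_apply, wordPerm_cycleWord_castSucc,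
        longest_apply, h.1, longest_apply, Fin.rev_succ]
  · rw [List.length_append, castSuccWord, List.length_map, List.length_reverse, cycleWord,
      List.length_finRange, h.2, inversions_longest_succ]

theorem IsReducedWord.succWord_append {l : List (Fin (n - 1))}
    (h : IsReducedWord l (longest n)) :
    IsReducedWord (succWord l ++ cycleWord n) (longest (n + 1)) := by
  rw [isReducedWord_iff] at h ⊢
  constructor
  · rw [wordPerm_append]
    ext k
    cases k using Fin.lastCases with
    | last =>
      rw [Equiv.Perm.mul_apply, wordPerm_cycleWord_last, wordPerm_succWord_zero, longest_apply,
        Fin.rev_last]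
    | cast k =>
      rw [Equiv.Perm.mul_apply, wordPerm_cycleWord_castSucc, wordPerm_succWord_succ,
        longest_apply, h.1, longest_apply, Fin.rev_castSucc]
  · rw [List.length_append, succWord, List.length_map, cycleWord, List.length_finRange, h.2,
      inversions_longest_succ]

end LongestWords

section Operators

theorem dvd_sub_map_of_forall_dvd_X_sub {σ R : Type*} [CommRing R] {p : MvPolynomial σ R}
    (φ : MvPolynomial σ R →ₐ[R] MvPolynomial σ R) (h : ∀ k, p ∣ X k - φ (X k))
    (f : MvPolynomial σ R) : p ∣ f - φ f := by
  induction f using MvPolynomial.induction_on with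
  | C c => simp [← algebraMap_eq]
  | add f g hf hg =>
    rw [map_add, add_sub_add_comm]
    exact dvd_add hf hg
  | mul_X f k hf =>
    have leibniz (g x y : MvPolynomial σ R) : f * x - g * y = (f - g) * x + g * (x - y) := by ring
    rw [map_mul, leibniz]
    exact dvd_add (hf.mul_right _) ((h k).mul_left _)

theorem X_sub_X_ne_zero {σ R : Type*} [CommRing R] [Nontrivial R] {a b : σ} (hab : a ≠ b) :
    (X a - X b : MvPolynomial σ R) ≠ 0 :=
  sub_ne_zero.2 (X_injective.ne hab)

variable {σ R : Type*} [DecidableEq σ] [CommRing R]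

theorem rename_swap_rename_swap (a b : σ) (f : MvPolynomial σ R) :
    rename (Equiv.swap a b) (rename (Equiv.swap a b) f) = f := by
  rw [rename_rename, ← Equiv.Perm.coe_mul, Equiv.swap_mul_self, Equiv.Perm.coe_one, rename_id_apply]

theorem X_sub_X_dvd_sub_rename_swap (a b : σ) (f : MvPolynomial σ R) :
    X a - X b ∣ f - rename (Equiv.swap a b) f := by
  refine dvd_sub_map_of_forall_dvd_X_sub (rename (Equiv.swap a b)) (fun k => ?_) f
  rw [rename_X]
  rcases eq_or_ne k a with rfl | hka
  · rw [Equiv.swap_apply_left]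
  rcases eq_or_ne k b with rfl | hkb
  · rw [Equiv.swap_apply_right, ← neg_sub, neg_dvd]
  · rw [Equiv.swap_apply_of_ne_of_ne hka hkb, sub_self]
    exact dvd_zero _

variable [IsDomain R]

/-- The divided difference operator `f ↦ (f - s f) / (x_a - x_b)`, where `s` interchanges `x_a`
and `x_b`; it is `0` for `a = b`. -/
def divDiff (a b : σ) : MvPolynomial σ R →ₗ[R] MvPolynomial σ R where
  toFun f := if a = b then 0 else (X_sub_X_dvd_sub_rename_swap a b f).choose
  map_add' f g := by
    split_ifs with hab
    · rw [add_zero]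
    apply mul_left_cancel₀ (X_sub_X_ne_zero (R := R) hab)
    have h (p : MvPolynomial σ R) := (X_sub_X_dvd_sub_rename_swap a b p).choose_spec
    linear_combination h f + h g - h (f + g) - map_add (rename (Equiv.swap a b)) f g
  map_smul' c f := by
    split_ifs with hab
    · rw [smul_zero]
    apply mul_left_cancel₀ (X_sub_X_ne_zero (R := R) hab)
    have h (p : MvPolynomial σ R) := (X_sub_X_dvd_sub_rename_swap a b p).choose_spec
    rw [RingHom.id_apply, mul_smul_comm, ← h f, smul_sub, ← map_smul]
    exact (h (c • f)).symm

theorem mul_divDiff (a b : σ) (f : MvPolynomial σ R) :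
    (X a - X b) * divDiff a b f = f - rename (Equiv.swap a b) f := by
  rcases eq_or_ne a b with rfl | hab
  · simp
  · simp only [divDiff, LinearMap.coe_mk, AddHom.coe_mk, if_neg hab]
    exact (X_sub_X_dvd_sub_rename_swap a b f).choose_spec.symm

theorem divDiff_rename_swap (a b : σ) (f : MvPolynomial σ R) :
    divDiff a b (rename (Equiv.swap a b) f) = -divDiff a b f := by
  rcases eq_or_ne a b with rfl | hab
  · simp [divDiff]
  apply mul_left_cancel₀ (X_sub_X_ne_zero (R := R) hab)
  rw [mul_neg, mul_divDiff, mul_divDiff, rename_swap_rename_swap, neg_sub]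

theorem divDiff_mul_X_pow {a b : σ} (hab : a ≠ b) {p : MvPolynomial σ R}
    (hp : rename (Equiv.swap a b) p = p) (k : ℕ) :
    divDiff a b (p * X a ^ k) = p * ∑ l ∈ Finset.range k, X a ^ l * X b ^ (k - 1 - l) := by
  apply mul_left_cancel₀ (X_sub_X_ne_zero (R := R) hab)
  rw [mul_divDiff, map_mul, hp, map_pow, rename_X, Equiv.swap_apply_left, mul_left_comm,
    (Commute.all (X a) (X b)).mul_geom_sum₂, mul_sub]

/-- The Demazure–Lusztig operator `f ↦ s • s_{ab} f - (1 - s) x_a (f - s_{ab} f) / (x_a - x_b)` on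
polynomials, where `s_{ab}` interchanges `x_a` and `x_b`. -/
def demLus (s : R) (a b : σ) : Module.End R (MvPolynomial σ R) :=
  s • (rename (Equiv.swap a b)).toLinearMap -
    (1 - s) • LinearMap.mulLeft R (X a) ∘ₗ divDiff a b

theorem demLus_apply (s : R) (a b : σ) (f : MvPolynomial σ R) :
    demLus s a b f = C s * rename (Equiv.swap a b) f - C (1 - s) * (X a * divDiff a b f) := by
  simp [demLus, smul_eq_C_mul]

theorem mul_demLus (s : R) (a b : σ) (f : MvPolynomial σ R) :
    (X a - X b) * demLus s a b f =
      (X a - C s * X b) * rename (Equiv.swap a b) f - C (1 - s) * X a * f := by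
  rw [demLus_apply, C_sub, C_1]
  linear_combination -(1 - C s) * X a * mul_divDiff a b f

theorem demLus_eq_of_mul_eq {s : R} {a b : σ} (hab : a ≠ b) {f g : MvPolynomial σ R}
    (h : (X a - X b) * g =
      (X a - C s * X b) * rename (Equiv.swap a b) f - C (1 - s) * X a * f) :
    demLus s a b f = g :=
  mul_left_cancel₀ (X_sub_X_ne_zero hab) ((mul_demLus s a b f).trans h.symm)

theorem mul_rename_demLus (s : R) (a b : σ) (f : MvPolynomial σ R) :
    (X b - X a) * rename (Equiv.swap a b) (demLus s a b f) =
      (X b - C s * X a) * f - C (1 - s) * X b * rename (Equiv.swap a b) f := by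
  simpa only [map_sub, map_mul, rename_X, rename_C, Equiv.swap_apply_left, Equiv.swap_apply_right,
    rename_swap_rename_swap] using congrArg (rename (Equiv.swap a b)) (mul_demLus s a b f)

theorem demLus_mul_of_symm (s : R) {a b : σ} (hab : a ≠ b) {p : MvPolynomial σ R}
    (hp : rename (Equiv.swap a b) p = p) (f : MvPolynomial σ R) :
    demLus s a b (p * f) = p * demLus s a b f := by
  apply demLus_eq_of_mul_eq hab
  rw [map_mul, hp]
  linear_combination p * mul_demLus s a b f

theorem demLus_one (s : R) {a b : σ} (hab : a ≠ b) : demLus s a b 1 = C s := by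
  apply demLus_eq_of_mul_eq hab
  simp only [map_sub, map_one]
  ring

theorem demLus_demLus (s : R) {a b : σ} (hab : a ≠ b) (f : MvPolynomial σ R) :
    demLus s a b (demLus s a b f) = C (s - 1) * demLus s a b f + C s * f := by
  apply demLus_eq_of_mul_eq hab
  apply mul_left_cancel₀ (X_sub_X_ne_zero (R := R) hab)
  have h := mul_demLus s a b f
  have h_rename := mul_rename_demLus s a b f
  simp only [map_sub, map_one] at h h_rename ⊢
  linear_combination ((C s - 1) * (X a - X b) + (1 - C s) * X a) * h + (X a - C s * X b) * h_rename

theorem demLus_injective {s : R} (hs : s ≠ 0) {a b : σ} (hab : a ≠ b) :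
    Function.Injective (demLus s a b) := by
  rw [injective_iff_map_eq_zero]
  intro f hf
  have h := demLus_demLus s hab f
  rw [hf, map_zero, mul_zero, zero_add] at h
  simpa [hs] using h.symm

theorem demLus_X_mul_demLus (s : R) {a b : σ} (hab : a ≠ b) (f : MvPolynomial σ R) :
    demLus s a b (X b * demLus s a b f) = C s * (X a * f) := by
  apply demLus_eq_of_mul_eq hab
  apply mul_left_cancel₀ (X_sub_X_ne_zero (R := R) hab)
  have h := mul_demLus s a b f
  have h_rename := mul_rename_demLus s a b f
  simp only [map_sub, map_one, map_mul, rename_X, Equiv.swap_apply_right] at h h_rename ⊢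
  linear_combination ((1 - C s) * X a * X b) * h + X a * (X a - C s * X b) * h_rename

/-- Only the homogeneity of `x_a / (x_a - x_b)` matters, so `φ` may multiply both variables by a
common factor `u`. -/
theorem map_demLus {τ S : Type*} [DecidableEq τ] [CommRing S] [IsDomain S]
    (φ : MvPolynomial σ R →+* MvPolynomial τ S) {u : MvPolynomial τ S} (hu : u ≠ 0) {s : R} {s' : S}
    {a b : σ} {c d : τ} (hcd : c ≠ d) (ha : φ (X a) = u * X c) (hb : φ (X b) = u * X d)
    (hs : φ (C s) = C s')
    (hφ : ∀ f, φ (rename (Equiv.swap a b) f) = rename (Equiv.swap c d) (φ f))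
    (f : MvPolynomial σ R) : φ (demLus s a b f) = demLus s' c d (φ f) := by
  refine (demLus_eq_of_mul_eq hcd (mul_left_cancel₀ hu ?_)).symm
  have h := congrArg φ (mul_demLus s a b f)
  simp only [map_sub, map_mul, map_one, ha, hb, hs, hφ] at h ⊢
  linear_combination h

theorem rename_demLus (w : Equiv.Perm σ) (s : R) {a b : σ} (hab : a ≠ b) (f : MvPolynomial σ R) :
    rename w (demLus s a b f) = demLus s (w a) (w b) (rename w f) := by
  refine map_demLus (rename w : MvPolynomial σ R →ₐ[R] _).toRingHom one_ne_zero (w.injective.ne hab)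
    ?_ ?_ ?_ (fun f => ?_) f
  · simp
  · simp
  · simp
  · simp only [AlgHom.toRingHom_eq_coe, RingHom.coe_coe, rename_rename, ← Equiv.Perm.coe_mul]
    rw [Equiv.mul_swap_eq_swap_mul]

theorem C_mul_demLus_of_mul_eq_one {s s' : R} (hs : s * s' = 1) {a b : σ} (hab : a ≠ b)
    (f : MvPolynomial σ R) :
    C s * demLus s' a b f = demLus s b a f + C (1 - s) * f := by
  rw [← sub_eq_iff_eq_add]
  refine (demLus_eq_of_mul_eq hab.symm ?_).symm
  have hC : (C s * C s' : MvPolynomial σ R) = 1 := by rw [← C_mul, hs, C_1]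
  have h := mul_demLus s' a b f
  simp only [map_sub, map_one, Equiv.swap_comm b a] at h ⊢
  linear_combination (-C s) * h + (X b * rename (Equiv.swap a b) f - X a * f) * hC

theorem demLus_comm (s : R) {a b c d : σ} (hab : a ≠ b) (hcd : c ≠ d) (hac : a ≠ c) (had : a ≠ d)
    (hbc : b ≠ c) (hbd : b ≠ d) : Commute (demLus s a b) (demLus s c d) := by
  have symm_a : rename (Equiv.swap c d) (X a : MvPolynomial σ R) = X a := by
    rw [rename_X, Equiv.swap_apply_of_ne_of_ne hac had]
  have symm_b : rename (Equiv.swap c d) (X b : MvPolynomial σ R) = X b := by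
    rw [rename_X, Equiv.swap_apply_of_ne_of_ne hbc hbd]
  refine LinearMap.ext fun f => ?_
  rw [Module.End.mul_apply, Module.End.mul_apply]
  apply demLus_eq_of_mul_eq hab
  rw [rename_demLus _ _ hcd, Equiv.swap_apply_of_ne_of_ne hac.symm hbc.symm,
    Equiv.swap_apply_of_ne_of_ne had.symm hbd.symm,
    ← demLus_mul_of_symm s hcd (by rw [map_sub, symm_a, symm_b]), mul_demLus, map_sub,
    demLus_mul_of_symm s hcd (by simp only [map_sub, map_mul, rename_C, symm_a, symm_b]),
    demLus_mul_of_symm s hcd (by simp only [map_mul, rename_C, symm_a])]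

theorem mul_eval_demLus (s : R) (a b : σ) (v : σ → R) (f : MvPolynomial σ R) :
    (v a - v b) * eval v (demLus s a b f) =
      (v a - s * v b) * eval (v ∘ Equiv.swap a b) f - (1 - s) * v a * eval v f := by
  simpa [eval_rename] using congrArg (eval v) (mul_demLus s a b f)

end Operators

section Braid

theorem braid_of_eq_div {K : Type*} [Field K] {a b c s : K} (hab : a ≠ b) (hac : a ≠ c)
    (hbc : b ≠ c) {σ τ : K →+* K} (hσa : σ a = b) (hσb : σ b = a) (hσc : σ c = c) (hσs : σ s = s)
    (hτa : τ a = a) (hτb : τ b = c) (hτc : τ c = b) (hτs : τ s = s) {T U : K → K}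
    (hT : ∀ f, T f = ((a - s * b) * σ f - (1 - s) * a * f) / (a - b))
    (hU : ∀ f, U f = ((b - s * c) * τ f - (1 - s) * b * f) / (b - c)) {f : K} (hσσ : σ (σ f) = f)
    (hττ : τ (τ f) = f) (hστσ : σ (τ (σ f)) = τ (σ (τ f))) : T (U (T f)) = U (T (U f)) := by
  have hab_sub := sub_ne_zero.2 hab
  have hac_sub := sub_ne_zero.2 hac
  have hbc_sub := sub_ne_zero.2 hbc
  have hba_sub := sub_ne_zero.2 hab.symm
  have hcb_sub := sub_ne_zero.2 hbc.symm
  simp only [hT, hU, map_div₀, map_sub, map_mul, map_one, hσa, hσb, hσc, hσs, hτa, hτb, hτc, hτs,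
    hσσ, hττ, hστσ]
  field_simp
  ring

variable {σ R : Type*} [DecidableEq σ] [CommRing R] [IsDomain R]

theorem map_demLus_eq_div {K : Type*} [Field K] {ι : MvPolynomial σ R →+* K}
    (hι : Function.Injective ι) (s : R) {a b : σ} (hab : a ≠ b) (f : MvPolynomial σ R) :
    ι (demLus s a b f) =
      ((ι (X a) - ι (C s) * ι (X b)) * ι (rename (Equiv.swap a b) f) -
        (1 - ι (C s)) * ι (X a) * ι f) / (ι (X a) - ι (X b)) := by
  rw [eq_div_iff (sub_ne_zero.2 (hι.ne (X_injective.ne hab))), mul_comm]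
  simpa only [map_sub, map_mul, map_one] using congrArg ι (mul_demLus s a b f)

theorem demLus_braid (s : R) {a b c : σ} (hab : a ≠ b) (hac : a ≠ c) (hbc : b ≠ c) :
    demLus s a b * demLus s b c * demLus s a b = demLus s b c * demLus s a b * demLus s b c := by
  let K := FractionRing (MvPolynomial σ R)
  let ι : MvPolynomial σ R →+* K := algebraMap _ K
  let swap (i j : σ) : K →+* K :=
    (IsFractionRing.ringEquivOfRingEquiv (renameEquiv R (Equiv.swap i j)).toRingEquiv : K ≃+* K)
  have swap_ι (i j f) : swap i j (ι f) = ι (rename (Equiv.swap i j) f) :=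
    IsFractionRing.ringEquivOfRingEquiv_algebraMap _ f
  have hι : Function.Injective ι := IsFractionRing.injective _ K
  have ι_X_ne {i j : σ} (hij : i ≠ j) : ι (X i) ≠ ι (X j) :=
    hι.ne (X_injective.ne hij)
  let T (i j : σ) (f : K) : K :=
    ((ι (X i) - ι (C s) * ι (X j)) * swap i j f - (1 - ι (C s)) * ι (X i) * f) /
      (ι (X i) - ι (X j))
  have ι_demLus {i j : σ} (hij : i ≠ j) (f) : ι (demLus s i j f) = T i j (ι f) := by
    rw [map_demLus_eq_div hι s hij f, ← swap_ι]
  refine LinearMap.ext fun f => hι ?_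
  simp only [Module.End.mul_apply]
  rw [ι_demLus hab, ι_demLus hbc, ι_demLus hab, ι_demLus hbc, ι_demLus hab, ι_demLus hbc]
  refine braid_of_eq_div (ι_X_ne hab) (ι_X_ne hac) (ι_X_ne hbc) ?_ ?_ ?_ ?_ ?_ ?_ ?_ ?_
    (fun _ => rfl) (fun _ => rfl) ?_ ?_ ?_
  all_goals simp only [swap_ι, rename_X, rename_C, rename_swap_rename_swap]
  · rw [Equiv.swap_apply_left]
  · rw [Equiv.swap_apply_right]
  · rw [Equiv.swap_apply_of_ne_of_ne hac.symm hbc.symm]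
  · rw [Equiv.swap_apply_of_ne_of_ne hab hac]
  · rw [Equiv.swap_apply_left]
  · rw [Equiv.swap_apply_right]
  · simp only [rename_rename, ← Equiv.Perm.coe_mul, swap_braid hab hac hbc]

end Braid

section Words

variable {n : ℕ} {R : Type*} [CommRing R] [IsDomain R]

theorem isBraidFamily_demLus (s : R) :
    IsBraidFamily fun i : Fin (n - 1) => demLus s (lo i) (hi i) where
  comm i j hij := demLus_comm s (lo_ne_hi i) (lo_ne_hi j)
    (by simp only [lo, ne_eq, Fin.ext_iff]; lia) (by simp only [lo, hi, ne_eq, Fin.ext_iff]; lia)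
    (by simp only [lo, hi, ne_eq, Fin.ext_iff]; lia) (by simp only [hi, ne_eq, Fin.ext_iff]; lia)
  braid i j hij := by
    have hbc := lo_ne_hi j
    rw [lo_eq_hi hij] at hbc ⊢
    exact demLus_braid s (lo_ne_hi i) (lo_ne_hi_of_le (by omega)) hbc

/-- The product of Demazure–Lusztig operators on polynomials given by a word: the restriction of
`heckeWord` to polynomials, over a general ring of coefficients. -/
def demLusWord (s : R) (l : List (Fin (n - 1))) : Module.End R (MvPolynomial (Fin n) R) :=
  (l.map fun i => demLus s (lo i) (hi i)).prod

@[simp] theorem demLusWord_cons (s : R) (i : Fin (n - 1)) (l : List (Fin (n - 1)))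
    (f : MvPolynomial (Fin n) R) :
    demLusWord s (i :: l) f = demLus s (lo i) (hi i) (demLusWord s l f) := by
  simp [demLusWord]

@[simp] theorem demLusWord_append (s : R) (l l' : List (Fin (n - 1)))
    (f : MvPolynomial (Fin n) R) :
    demLusWord s (l ++ l') f = demLusWord s l (demLusWord s l' f) := by
  simp [demLusWord]

theorem demLusWord_eq_of_isReducedWord (s : R) {w : Equiv.Perm (Fin n)}
    {l l' : List (Fin (n - 1))} (hl : IsReducedWord l w) (hl' : IsReducedWord l' w) :
    demLusWord s l = demLusWord s l' :=
  (isBraidFamily_demLus s).prod_map_eq hl hl'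

theorem demLusWord_longest_demLus (s : R) {l : List (Fin (n - 1))}
    (hl : IsReducedWord l (longest n)) (i : Fin (n - 1)) (f : MvPolynomial (Fin n) R) :
    demLusWord s l (demLus s (lo i) (hi i) f) =
      demLus s (lo i.rev) (hi i.rev) (demLusWord s l f) :=
  LinearMap.congr_fun ((isBraidFamily_demLus s).prod_map_longest_mul hl i) f

theorem demLusWord_one (s : R) (l : List (Fin (n - 1))) : demLusWord s l 1 = C (s ^ l.length) := by
  induction l with
  | nil => simp [demLusWord]
  | cons i l ih =>
    rw [demLusWord_cons, ih, ← mul_one (C _), demLus_mul_of_symm _ (lo_ne_hi i) (rename_C _ _),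
      demLus_one _ (lo_ne_hi i), ← C_mul, List.length_cons, pow_succ]

theorem demLusWord_injective {s : R} (hs : s ≠ 0) (l : List (Fin (n - 1))) :
    Function.Injective (demLusWord s l) := by
  induction l with
  | nil => exact Function.injective_id
  | cons i l ih =>
    intro f g h
    rw [demLusWord_cons, demLusWord_cons] at h
    exact ih (demLus_injective hs (lo_ne_hi i) h)

theorem C_mul_rename_longest_demLus {s s' : R} (hs : s * s' = 1) (i : Fin (n - 1))
    (f : MvPolynomial (Fin n) R) :
    C s * rename (longest n) (demLus s' (lo i) (hi i) f) =
      demLus s (lo i.rev) (hi i.rev) (rename (longest n) f) +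
        C (1 - s) * rename (longest n) f := by
  rw [rename_demLus _ _ (lo_ne_hi i), longest_apply, longest_apply, rev_lo, rev_hi,
    C_mul_demLus_of_mul_eq_one hs (lo_ne_hi _).symm]

end Words

section RationalFunctions

variable {n : ℕ}

theorem permute_algebraMap (w : Equiv.Perm (Fin n)) (f : PolyRing n) :
    permute w (algebraMap (PolyRing n) (RatFun n) f) =
      algebraMap (PolyRing n) (RatFun n) (rename w f) :=
  (IsFractionRing.liftAlgHom_apply _ _).trans (IsFractionRing.lift_algebraMap _ f)

theorem demazureLusztig_algebraMap (s : BaseField) (i : Fin (n - 1)) (f : PolyRing n) :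
    demazureLusztig s i (algebraMap (PolyRing n) (RatFun n) f) =
      algebraMap (PolyRing n) (RatFun n) (demLus s (lo i) (hi i) f) := by
  have hinj := IsFractionRing.injective (PolyRing n) (RatFun n)
  have hne : algebraMap _ (RatFun n) (X (lo i)) - algebraMap (PolyRing n) _ (X (hi i)) ≠ 0 :=
    sub_ne_zero.2 (hinj.ne (X_injective.ne (lo_ne_hi i)))
  have hC (c : BaseField) : algebraMap BaseField (RatFun n) c =
      algebraMap (PolyRing n) (RatFun n) (C c) :=
    IsScalarTower.algebraMap_apply BaseField (PolyRing n) (RatFun n) c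
  rw [map_demLus_eq_div hinj s (lo_ne_hi i), ← simple, eq_div_iff hne]
  simp only [demazureLusztig, LinearMap.sub_apply, LinearMap.smul_apply, AlgHom.toLinearMap_apply,
    permute_algebraMap, Module.End.mul_apply, LinearMap.mulLeft_apply, Module.End.one_apply]
  rw [Algebra.smul_def]
  simp only [hC, x, map_sub, map_one]
  field_simp
  ring

theorem heckeWord_algebraMap (s : BaseField) (l : List (Fin (n - 1))) (f : PolyRing n) :
    heckeWord s l (algebraMap (PolyRing n) (RatFun n) f) =
      algebraMap (PolyRing n) (RatFun n) (demLusWord s l f) := by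
  induction l with
  | nil => rfl
  | cons i l ih =>
    rw [demLusWord_cons, ← demazureLusztig_algebraMap, ← ih]
    rfl

end RationalFunctions

section GroundField

theorem q_pow_mul_t_pow_injective {a b c d : ℕ} (h : q ^ a * t ^ b = q ^ c * t ^ d) :
    a = c ∧ b = d := by
  have hX : (X 0 ^ a * X 1 ^ b : MvPolynomial (Fin 2) ℚ) = X 0 ^ c * X 1 ^ d :=
    IsFractionRing.injective (MvPolynomial (Fin 2) ℚ) BaseField <| by
      rwa [map_mul, map_pow, map_pow, map_mul, map_pow, map_pow]
  simp only [X_pow_eq_monomial, monomial_mul, mul_one] at hX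
  have hexp := monomial_left_injective one_ne_zero hX
  have hexp_q := DFunLike.congr_fun hexp 0
  have hexp_t := DFunLike.congr_fun hexp 1
  simp only [Finsupp.coe_add, Pi.add_apply, Finsupp.single_apply] at hexp_q hexp_t
  simpa using And.intro hexp_q hexp_t

theorem q_zpow_mul_t_zpow_injective {a b c d : ℤ} (h : q ^ a * t ^ b = q ^ c * t ^ d) :
    a = c ∧ b = d := by
  obtain ⟨k, ha, hb, hc, hd⟩ : ∃ k : ℤ, 0 ≤ a + k ∧ 0 ≤ b + k ∧ 0 ≤ c + k ∧ 0 ≤ d + k :=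
    ⟨|a| + |b| + |c| + |d|, by grind, by grind, by grind, by grind⟩
  have hshift : q ^ (a + k) * t ^ (b + k) = q ^ (c + k) * t ^ (d + k) := by
    simp only [zpow_add₀ q_ne_zero, zpow_add₀ t_ne_zero]
    linear_combination q ^ k * t ^ k * h
  rw [← Int.toNat_of_nonneg ha, ← Int.toNat_of_nonneg hb, ← Int.toNat_of_nonneg hc,
    ← Int.toNat_of_nonneg hd] at hshift
  simp only [zpow_natCast] at hshift
  have hexp := q_pow_mul_t_pow_injective hshift
  omega

theorem iota_iota (c : BaseField) : iota (iota c) = c := by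
  suffices h : iota.comp iota = RingHom.id BaseField from RingHom.congr_fun h c
  apply IsLocalization.ringHom_ext (nonZeroDivisors (MvPolynomial (Fin 2) ℚ))
  refine MvPolynomial.ringHom_ext (fun r => ?_) (fun i => ?_)
  · have hC : algebraMap (MvPolynomial (Fin 2) ℚ) BaseField (C r) = (r : BaseField) :=
      eq_ratCast ((algebraMap (MvPolynomial (Fin 2) ℚ) BaseField).comp C) r
    simp [hC]
  · fin_cases i
    · change iota (iota q) = q
      rw [iota_q, map_inv₀, iota_q, inv_inv]
    · change iota (iota t) = t
      rw [iota_t, map_inv₀, iota_t, inv_inv]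

variable {n : ℕ}

/-- The semilinear ring involution `f ↦ f°(t^(n-1) x)` of `𝔽[x]`. -/
def dual : PolyRing n →+* PolyRing n :=
  (bind₁ fun i => C (t ^ ((n : ℤ) - 1)) * X i : PolyRing n →ₐ[BaseField] PolyRing n).toRingHom.comp
    (map iota)

theorem dual_apply (f : PolyRing n) : dual f = scale (t ^ ((n : ℤ) - 1)) (circ f) := rfl

@[simp] theorem dual_C (c : BaseField) : dual (C c : PolyRing n) = C (iota c) := by
  simp [dual]

@[simp] theorem dual_X (i : Fin n) :
    dual (X i : PolyRing n) = C (t ^ ((n : ℤ) - 1)) * X i := by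
  simp [dual]

theorem dual_dual (f : PolyRing n) : dual (dual f) = f := by
  suffices h : dual.comp dual = RingHom.id (PolyRing n) from RingHom.congr_fun h f
  refine MvPolynomial.ringHom_ext (fun c => ?_) (fun i => ?_)
  · simp [iota_iota]
  · rw [RingHom.comp_apply, dual_X, map_mul, dual_C, dual_X, ← mul_assoc, ← C_mul, map_zpow₀,
      iota_t, inv_zpow, inv_mul_cancel₀ (zpow_ne_zero _ t_ne_zero), C_1, one_mul, RingHom.id_apply]

theorem dual_rename (w : Equiv.Perm (Fin n)) (f : PolyRing n) :
    dual (rename w f) = rename w (dual f) := by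
  suffices h : dual.comp (rename w : PolyRing n →ₐ[BaseField] PolyRing n).toRingHom =
      (rename w : PolyRing n →ₐ[BaseField] PolyRing n).toRingHom.comp dual from
    RingHom.congr_fun h f
  refine MvPolynomial.ringHom_ext (fun c => ?_) (fun i => ?_) <;> simp

theorem dual_demLusWord (l : List (Fin (n - 1))) (f : PolyRing n) :
    dual (demLusWord t l f) = demLusWord t⁻¹ l (dual f) := by
  induction l with
  | nil => rfl
  | cons i l ih =>
    have hne : (C (t ^ ((n : ℤ) - 1)) : PolyRing n) ≠ 0 :=
      C_ne_zero.2 (zpow_ne_zero _ t_ne_zero)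
    rw [demLusWord_cons, demLusWord_cons, ← ih]
    exact map_demLus dual hne (lo_ne_hi i) (dual_X _) (dual_X _) (by rw [dual_C, iota_t])
      (dual_rename _) _

theorem eval_dual (v : Fin n → BaseField) (f : PolyRing n) :
    eval (fun i => t ^ (1 - (n : ℤ)) * iota (v i)) (dual f) = iota (eval v f) := by
  suffices h : (eval fun i => t ^ (1 - (n : ℤ)) * iota (v i)).comp dual = iota.comp (eval v) from
    RingHom.congr_fun h f
  refine MvPolynomial.ringHom_ext (fun c => ?_) (fun i => ?_)
  · simp
  · rw [RingHom.comp_apply, dual_X, RingHom.comp_apply, eval_mul, eval_C, eval_X, eval_X,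
      ← mul_assoc, ← zpow_add₀ t_ne_zero]
    simp

end GroundField

section SpectralVectors

variable {n : ℕ}

theorem kStat_eq_card (v : Fin n → ℤ) (i : Fin n) :
    kStat v i = (Finset.univ.filter fun k => v i < v k ∨ (v k = v i ∧ k < i)).card := by
  rw [kStat, ← Finset.card_union_of_disjoint]
  · congr 1
    grind
  · rw [Finset.disjoint_filter]
    grind

theorem kStat_hi {v : Fin n → ℤ} {i : Fin (n - 1)} (h : v (lo i) = v (hi i)) :
    kStat v (hi i) = kStat v (lo i) + 1 := by
  have hmem : lo i ∉ Finset.univ.filter fun k => v (lo i) < v k ∨ (v k = v (lo i) ∧ k < lo i) := by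
    simp
  have hlt (k : Fin n) : k < hi i ↔ k = lo i ∨ k < lo i := by
    simp only [lo, hi, Fin.lt_def, Fin.ext_iff]
    omega
  rw [kStat_eq_card, kStat_eq_card, ← Finset.card_insert_of_notMem hmem]
  congr 1
  grind

theorem simple_lt_simple_iff {v : Fin n → ℤ} {i : Fin (n - 1)} (h : v (lo i) ≠ v (hi i))
    {j k : Fin n} (hjk : v j = v k) : simple i j < simple i k ↔ j < k := by
  have hmono {a b : Fin n} (hab : v a = v b) (hlt : a < b) : simple i a < simple i b :=
    simple_lt_simple hlt (by rintro ⟨rfl, rfl⟩; exact h hab)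
  refine ⟨fun hlt => ?_, hmono hjk⟩
  rcases lt_trichotomy j k with hlt' | rfl | hgt
  · exact hlt'
  · exact absurd hlt (lt_irrefl _)
  · exact absurd hlt (hmono hjk.symm hgt).asymm

theorem kStat_comp_simple {v : Fin n → ℤ} {i : Fin (n - 1)} (h : v (lo i) ≠ v (hi i))
    (j : Fin n) : kStat (v ∘ simple i) j = kStat v (simple i j) := by
  rw [kStat_eq_card, kStat_eq_card]
  refine Finset.card_equiv (simple i) fun k => ?_
  simp only [Finset.mem_filter, Finset.mem_univ, true_and, Function.comp_apply]
  refine or_congr_right (and_congr_right fun hkj => ?_)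
  rw [← simple_lt_simple_iff h hkj, simple_simple, simple_simple]

theorem kStat_neg_rev (v : Fin n → ℤ) (i : Fin n) :
    kStat (fun k => -v k.rev) i + kStat v i.rev + 1 = n := by
  have hrev : kStat (fun k => -v k.rev) i =
      (Finset.univ.filter fun k => v k < v i.rev ∨ (v k = v i.rev ∧ i.rev < k)).card := by
    rw [kStat_eq_card]
    refine Finset.card_equiv Fin.revPerm fun k => ?_
    simp [Fin.rev_lt_rev]
  have hdisj : Disjoint
      (Finset.univ.filter fun k => v k < v i.rev ∨ (v k = v i.rev ∧ i.rev < k))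
      (Finset.univ.filter fun k => v i.rev < v k ∨ (v k = v i.rev ∧ k < i.rev)) := by
    rw [Finset.disjoint_filter]
    grind
  have hunion : (Finset.univ.filter fun k => v k < v i.rev ∨ (v k = v i.rev ∧ i.rev < k)) ∪
      (Finset.univ.filter fun k => v i.rev < v k ∨ (v k = v i.rev ∧ k < i.rev)) =
      Finset.univ.erase i.rev := by
    grind
  rw [hrev, kStat_eq_card, ← Finset.card_union_of_disjoint hdisj, hunion,
    Finset.card_erase_add_one (Finset.mem_univ _), Finset.card_univ, Fintype.card_fin]

/-- The spectral vector of a composition. -/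
def point (β : Fin n → ℕ) : Fin n → BaseField := bar fun i => (β i : ℤ)

/-- The statistic `kStat` of a composition. -/
def kComp (β : Fin n → ℕ) : Fin n → ℕ := kStat fun i => (β i : ℤ)

theorem kComp_eq_card (β : Fin n → ℕ) (i : Fin n) :
    kComp β i = (Finset.univ.filter fun k => β i < β k ∨ (β k = β i ∧ k < i)).card := by
  rw [kComp, kStat_eq_card]
  simp only [Nat.cast_lt, Nat.cast_inj]

theorem point_apply (β : Fin n → ℕ) (i : Fin n) :
    point β i = q ^ (β i : ℤ) * t ^ (-(kComp β i : ℤ)) := rfl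

theorem point_ne_zero (β : Fin n → ℕ) (i : Fin n) : point β i ≠ 0 :=
  mul_ne_zero (zpow_ne_zero _ q_ne_zero) (zpow_ne_zero _ t_ne_zero)

theorem point_lo_eq_mul_point_hi {β : Fin n → ℕ} {i : Fin (n - 1)} (h : β (lo i) = β (hi i)) :
    point β (lo i) = t * point β (hi i) := by
  rw [point_apply, point_apply, h, kComp, kStat_hi (by simp [h]), mul_left_comm,
    ← zpow_one_add₀ t_ne_zero]
  congr 2
  push_cast
  ring

theorem point_lo_ne_point_hi (β : Fin n → ℕ) (i : Fin (n - 1)) :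
    point β (lo i) ≠ point β (hi i) := by
  intro h
  obtain ⟨hβ, hk⟩ := q_zpow_mul_t_zpow_injective h
  rw [kStat_hi (v := fun i => (β i : ℤ)) hβ] at hk
  push_cast at hk
  omega

theorem point_comp_simple {β : Fin n → ℕ} {i : Fin (n - 1)} (h : β (lo i) ≠ β (hi i)) :
    point (β ∘ simple i) = point β ∘ simple i := by
  funext j
  have hk : kComp (β ∘ simple i) j = kComp β (simple i j) :=
    kStat_comp_simple (v := fun i => (β i : ℤ)) (by simpa using h) j
  rw [Function.comp_apply, point_apply, point_apply, hk]
  rfl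

theorem tilde_eq (β : Fin n → ℕ) :
    tilde (fun i => (β i : ℤ)) = fun i => t ^ (1 - (n : ℤ)) * iota (point β (longest n i)) := by
  funext i
  have hk := kStat_neg_rev (fun i => (β i : ℤ)) i
  rw [longest_apply, point_apply, map_mul, map_zpow₀, map_zpow₀, iota_q, iota_t, tilde, bar,
    inv_zpow', inv_zpow', mul_left_comm, ← zpow_add₀ t_ne_zero]
  congr 2
  rw [kComp]
  omega

theorem size_cons (a : ℕ) (β : Fin n → ℕ) :
    size (Fin.cons a β : Fin (n + 1) → ℕ) = a + size β := by
  simp [size, Fin.sum_univ_succ]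

theorem size_snoc (a : ℕ) (β : Fin n → ℕ) :
    size (Fin.snoc β a : Fin (n + 1) → ℕ) = size β + a := by
  simp [size, Fin.sum_univ_castSucc]

theorem kComp_cons_zero (a : ℕ) (β : Fin n → ℕ) :
    kComp (Fin.cons a β : Fin (n + 1) → ℕ) 0 = (Finset.univ.filter fun k => a < β k).card := by
  rw [kComp_eq_card, Finset.card_filter, Finset.card_filter, Fin.sum_univ_succ]
  simp

theorem kComp_cons_succ (a : ℕ) (β : Fin n → ℕ) (i : Fin n) :
    kComp (Fin.cons a β : Fin (n + 1) → ℕ) i.succ = (if β i ≤ a then 1 else 0) + kComp β i := by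
  rw [kComp_eq_card, kComp_eq_card, Finset.card_filter, Finset.card_filter, Fin.sum_univ_succ]
  simp [le_iff_lt_or_eq, eq_comm]

theorem kComp_snoc_last (a : ℕ) (β : Fin n → ℕ) :
    kComp (Fin.snoc β a : Fin (n + 1) → ℕ) (Fin.last n) =
      (Finset.univ.filter fun k => a ≤ β k).card := by
  rw [kComp_eq_card, Finset.card_filter, Finset.card_filter, Fin.sum_univ_castSucc]
  simp [le_iff_lt_or_eq, eq_comm, Fin.castSucc_lt_last]

theorem kComp_snoc_castSucc (a : ℕ) (β : Fin n → ℕ) (i : Fin n) :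
    kComp (Fin.snoc β a : Fin (n + 1) → ℕ) i.castSucc =
      kComp β i + (if β i < a then 1 else 0) := by
  rw [kComp_eq_card, kComp_eq_card, Finset.card_filter, Finset.card_filter,
    Fin.sum_univ_castSucc]
  simp [(Fin.castSucc_lt_last _).not_gt]

theorem point_snoc_succ_last (a : ℕ) (β : Fin n → ℕ) :
    point (Fin.snoc β (a + 1) : Fin (n + 1) → ℕ) (Fin.last n) =
      q * point (Fin.cons a β : Fin (n + 1) → ℕ) 0 := by
  rw [point_apply, point_apply, kComp_snoc_last, kComp_cons_zero, ← mul_assoc,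
    ← zpow_one_add₀ q_ne_zero]
  simp [add_comm]

theorem point_snoc_succ_castSucc (a : ℕ) (β : Fin n → ℕ) (i : Fin n) :
    point (Fin.snoc β (a + 1) : Fin (n + 1) → ℕ) i.castSucc =
      point (Fin.cons a β : Fin (n + 1) → ℕ) i.succ := by
  rw [point_apply, point_apply, kComp_snoc_castSucc, kComp_cons_succ]
  simp [add_comm]

theorem point_snoc_zero (β : Fin n → ℕ) :
    point (Fin.snoc β 0 : Fin (n + 1) → ℕ) = Fin.snoc (point β) (t ^ (-(n : ℤ))) := by
  funext i
  refine Fin.lastCases ?_ (fun i => ?_) i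
  · rw [point_apply, kComp_snoc_last]
    simp
  · rw [point_apply, kComp_snoc_castSucc]
    simp [point_apply]

theorem point_snoc_succ_last_ne (a : ℕ) (β : Fin n → ℕ) :
    point (Fin.snoc β (a + 1) : Fin (n + 1) → ℕ) (Fin.last n) ≠ t ^ (-(n : ℤ)) := by
  intro h
  rw [point_apply, Fin.snoc_last, ← one_mul (t ^ (-(n : ℤ))), ← zpow_zero q] at h
  have hq := (q_zpow_mul_t_zpow_injective h).1
  omega

end SpectralVectors

section Support

variable {σ τ R : Type*} [CommRing R]

/-- The polynomials all of whose exponents satisfy `P`. -/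
def supp (R : Type*) [CommRing R] (P : (σ → ℕ) → Prop) : Submodule R (MvPolynomial σ R) :=
  restrictSupport R {γ | P γ}

variable {P P' : (σ → ℕ) → Prop} {f : MvPolynomial σ R}

theorem mem_supp : f ∈ supp R P ↔ ∀ γ : σ →₀ ℕ, coeff γ f ≠ 0 → P γ := by
  simp only [supp, mem_restrictSupport_iff, Set.subset_def, Finset.mem_coe, mem_support_iff,
    Set.mem_ofPred_eq]

theorem supp_mono (h : ∀ γ, P γ → P' γ) (hf : f ∈ supp R P) : f ∈ supp R P' :=
  restrictSupport_mono _ (fun γ => h γ) hf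

theorem C_mul_mem_supp (c : R) (hf : f ∈ supp R P) : C c * f ∈ supp R P := by
  rw [← smul_eq_C_mul]
  exact Submodule.smul_mem _ c hf

theorem eq_zero_of_mem_supp (hf : f ∈ supp R P) (hP : ∀ γ, ¬P γ) : f = 0 := by
  ext γ
  by_contra h
  exact hP γ (mem_supp.1 hf γ h)

section Finite

variable [Finite σ]

theorem coeff_eq_zero_of_mem_supp (hf : f ∈ supp R P) {α : σ → ℕ} (hα : ¬P α) :
    coeff (Finsupp.equivFunOnFinite.symm α) f = 0 := by
  by_contra h
  exact hα (mem_supp.1 hf _ h)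

/-- The monomial `x^γ`. -/
def mon (γ : σ → ℕ) : MvPolynomial σ R := monomial (Finsupp.equivFunOnFinite.symm γ) 1

theorem coeff_mon_self (γ : σ → ℕ) :
    coeff (Finsupp.equivFunOnFinite.symm γ) (mon γ : MvPolynomial σ R) = 1 := by
  classical rw [mon, coeff_monomial, if_pos rfl]

theorem mon_mem_supp {γ : σ → ℕ} (h : P γ) : mon γ ∈ supp R P := by
  rw [supp, mon, monomial_mem_restrictSupport]
  exact Or.inl h

theorem monomial_eq_smul_mon (γ : σ →₀ ℕ) (c : R) : monomial γ c = c • mon ⇑γ := by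
  rw [mon, smul_monomial, smul_eq_mul, mul_one]
  exact congrArg (monomial · c) (Finsupp.equivFunOnFinite.symm_apply_apply γ).symm

theorem map_mem_supp (L : MvPolynomial σ R →ₗ[R] MvPolynomial τ R) {Q : (τ → ℕ) → Prop}
    (h : ∀ γ, P γ → L (mon γ) ∈ supp R Q) (hf : f ∈ supp R P) : L f ∈ supp R Q := by
  rw [f.as_sum, map_sum]
  refine Submodule.sum_mem _ fun γ hγ => ?_
  rw [monomial_eq_smul_mon, map_smul]
  exact Submodule.smul_mem _ _ (h γ (mem_supp.1 hf γ (mem_support_iff.1 hγ)))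

theorem sub_coeff_mul_mon_mem_supp (hf : f ∈ supp R P) (α : σ → ℕ) :
    f - C (coeff (Finsupp.equivFunOnFinite.symm α) f) * mon α ∈
      supp R fun γ => P γ ∧ γ ≠ α := by
  refine mem_supp.2 fun γ hγ => ?_
  classical
  rw [coeff_sub, coeff_C_mul, mon, coeff_monomial] at hγ
  have hne : Finsupp.equivFunOnFinite.symm α ≠ γ := by
    rintro rfl
    simp at hγ
  rw [if_neg hne, mul_zero, sub_zero] at hγ
  refine ⟨mem_supp.1 hf γ hγ, fun h => hne ?_⟩
  rw [← h]
  exact Finsupp.equivFunOnFinite.symm_apply_apply γ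

theorem coeff_map_of_mem_supp [Finite τ] (L : MvPolynomial σ R →ₗ[R] MvPolynomial τ R)
    {α : σ → ℕ} {β : τ → ℕ}
    (h : ∀ γ, P γ → γ ≠ α → L (mon γ) ∈ supp R fun δ => δ ≠ β) (hf : f ∈ supp R P) :
    coeff (Finsupp.equivFunOnFinite.symm β) (L f) =
      coeff (Finsupp.equivFunOnFinite.symm α) f *
        coeff (Finsupp.equivFunOnFinite.symm β) (L (mon α)) := by
  have hrest := map_mem_supp L (fun γ hγ => h γ hγ.1 hγ.2) (sub_coeff_mul_mon_mem_supp hf α)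
  have hcoeff := coeff_eq_zero_of_mem_supp hrest (α := β) fun hβ => hβ rfl
  rwa [map_sub, coeff_sub, ← smul_eq_C_mul, map_smul, coeff_smul, smul_eq_mul, sub_eq_zero]
    at hcoeff

theorem mon_eq_prod [Fintype σ] (γ : σ → ℕ) : (mon γ : MvPolynomial σ R) = ∏ i, X i ^ γ i := by
  rw [mon, monomial_eq, C_1, one_mul, Finsupp.prod_fintype _ _ (by simp)]
  rfl

theorem mon_add (γ δ : σ → ℕ) : (mon (γ + δ) : MvPolynomial σ R) = mon γ * mon δ := by
  cases nonempty_fintype σ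
  simp only [mon_eq_prod, Pi.add_apply, pow_add, Finset.prod_mul_distrib]

theorem mon_single [DecidableEq σ] (a : σ) (k : ℕ) :
    (mon (Pi.single a k) : MvPolynomial σ R) = X a ^ k := by
  cases nonempty_fintype σ
  simp [mon_eq_prod, Pi.single_apply, apply_ite]

theorem rename_mon (w : Equiv.Perm σ) (γ : σ → ℕ) :
    rename w (mon γ : MvPolynomial σ R) = mon (γ ∘ w.symm) := by
  cases nonempty_fintype σ
  rw [mon_eq_prod, mon_eq_prod, map_prod, ← Equiv.prod_comp w fun i => X i ^ (γ ∘ w.symm) i]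
  simp

end Finite

end Support

section Degree

variable {n m d : ℕ} {R : Type*} [CommRing R]

theorem size_eq_degree (γ : Fin n →₀ ℕ) : size γ = γ.degree :=
  (Finsupp.degree_eq_sum γ).symm

/-- The polynomials of degree less than `d`; unlike for `restrictTotalDegree`, the zero submodule
is included as the case `d = 0`. -/
abbrev degreeLT (R : Type*) [CommRing R] (n d : ℕ) : Submodule R (MvPolynomial (Fin n) R) :=
  supp R fun γ => size γ < d

/-- The homogeneous polynomials of degree `d`, presented by their exponents. -/
abbrev degreeEq (R : Type*) [CommRing R] (n d : ℕ) : Submodule R (MvPolynomial (Fin n) R) :=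
  supp R fun γ => size γ = d

theorem mem_degreeLT_succ {f : MvPolynomial (Fin n) R} :
    f ∈ degreeLT R n (d + 1) ↔ f.totalDegree ≤ d := by
  simp only [mem_supp, totalDegree, Finset.sup_le_iff, mem_support_iff, Nat.lt_succ_iff, size,
    Finsupp.sum_fintype, implies_true]

theorem eq_zero_of_mem_degreeLT_zero {f : MvPolynomial (Fin n) R} (hf : f ∈ degreeLT R n 0) :
    f = 0 :=
  eq_zero_of_mem_supp hf fun _ => Nat.not_lt_zero _

theorem eq_zero_of_mem_degreeLT_of_mem_degreeEq {f : MvPolynomial (Fin n) R}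
    (hlt : f ∈ degreeLT R n d) (heq : f ∈ degreeEq R n d) : f = 0 := by
  ext γ
  by_contra h
  exact (mem_supp.1 hlt γ h).ne (mem_supp.1 heq γ h)

theorem mem_degreeLT_iff_homogeneousComponent_eq_zero {f : MvPolynomial (Fin n) R}
    (hf : f.totalDegree ≤ d) : f ∈ degreeLT R n d ↔ homogeneousComponent d f = 0 := by
  rw [← mem_degreeLT_succ, mem_supp] at hf
  refine ⟨fun h => homogeneousComponent_eq_zero' _ _ fun γ hγ => ?_,
    fun h => mem_supp.2 fun γ hγ => ?_⟩
  · rw [← size_eq_degree]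
    exact (mem_supp.1 h γ (mem_support_iff.1 hγ)).ne
  · refine lt_of_le_of_ne (Nat.lt_succ_iff.1 (hf γ hγ)) fun hd => hγ ?_
    rw [size_eq_degree] at hd
    have hcoeff := coeff_homogeneousComponent d γ (φ := f)
    rwa [h, coeff_zero, if_pos hd, eq_comm] at hcoeff

theorem mul_mem_degreeLT {f g : MvPolynomial (Fin n) R} (hf : f.totalDegree ≤ 1)
    (hg : g ∈ degreeLT R n d) : f * g ∈ degreeLT R n (d + 1) := by
  rcases d with _ | d
  · rw [eq_zero_of_mem_degreeLT_zero hg, mul_zero]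
    exact Submodule.zero_mem _
  · rw [mem_degreeLT_succ] at hg ⊢
    exact (totalDegree_mul f g).trans (by omega)

theorem totalDegree_C_mul_X_le {σ : Type*} (c : R) (k : σ) :
    (C c * X k : MvPolynomial σ R).totalDegree ≤ 1 := by
  rw [C_mul_X_eq_monomial]
  exact (totalDegree_monomial_le _ _).trans (by simp)

theorem totalDegree_X_le {σ : Type*} (k : σ) : (X k : MvPolynomial σ R).totalDegree ≤ 1 :=
  (totalDegree_monomial_le _ _).trans (by simp)

theorem totalDegree_X_sub_C_le {σ : Type*} (k : σ) (c : R) :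
    (X k - C c : MvPolynomial σ R).totalDegree ≤ 1 :=
  (totalDegree_sub_C_le _ _).trans (totalDegree_X_le k)

theorem X_mul_mem_degreeEq (k : Fin n) {f : MvPolynomial (Fin n) R} (hf : f ∈ degreeEq R n d) :
    X k * f ∈ degreeEq R n (d + 1) := by
  refine map_mem_supp (LinearMap.mulLeft R (X k)) (fun γ hγ => ?_) hf
  rw [LinearMap.mulLeft_apply, ← pow_one (X k), ← mon_single, ← mon_add]
  refine mon_mem_supp ?_
  rw [← hγ, size, size]
  simp [Finset.sum_add_distrib, add_comm]

theorem mem_degreeLT_of_X_sub_C_mul_mem [IsDomain R] {k : Fin n} {c : R}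
    {f : MvPolynomial (Fin n) R} (h : (X k - C c) * f ∈ degreeLT R n (d + 1)) :
    f ∈ degreeLT R n d := by
  rcases eq_or_ne f 0 with rfl | hf
  · exact Submodule.zero_mem _
  have hdeg : 0 < (X k - C c : MvPolynomial (Fin n) R).totalDegree := by
    have hX := totalDegree_add (X k - C c : MvPolynomial (Fin n) R) (C c)
    rw [sub_add_cancel, totalDegree_X, totalDegree_C, Nat.max_zero] at hX
    exact hX
  have hne : (X k - C c : MvPolynomial (Fin n) R) ≠ 0 := by
    intro h_zero
    rw [h_zero, totalDegree_zero] at hdeg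
    exact hdeg.false
  rw [mem_degreeLT_succ, totalDegree_mul_of_isDomain hne hf] at h
  obtain ⟨d, rfl⟩ : ∃ e, d = e + 1 := ⟨d - 1, by omega⟩
  rw [mem_degreeLT_succ]
  omega

theorem mem_degreeLT_of_X_mul_mem [IsDomain R] {k : Fin n} {f : MvPolynomial (Fin n) R}
    (h : X k * f ∈ degreeLT R n (d + 1)) : f ∈ degreeLT R n d :=
  mem_degreeLT_of_X_sub_C_mul_mem (k := k) (c := 0) (by rwa [C_0, sub_zero])

theorem bind₁_mem_degreeLT {φ : Fin n → MvPolynomial (Fin m) R}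
    (hφ : ∀ i, (φ i).totalDegree ≤ 1) {f : MvPolynomial (Fin n) R} (hf : f ∈ degreeLT R n d) :
    bind₁ φ f ∈ degreeLT R m d := by
  refine map_mem_supp (bind₁ φ).toLinearMap (fun γ hγ => ?_) hf
  rcases d with _ | d
  · exact absurd hγ (Nat.not_lt_zero _)
  rw [mem_degreeLT_succ, AlgHom.toLinearMap_apply, mon_eq_prod, map_prod]
  calc (∏ i, bind₁ φ (X i ^ γ i)).totalDegree
      ≤ ∑ i, (bind₁ φ (X i ^ γ i)).totalDegree := totalDegree_finsetProd _ _
    _ ≤ ∑ i, γ i := Finset.sum_le_sum fun i _ => by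
        rw [map_pow, bind₁_X_right]
        exact (totalDegree_pow _ _).trans ((Nat.mul_le_mul_left _ (hφ i)).trans_eq (mul_one _))
    _ ≤ d := Nat.lt_succ_iff.1 hγ

theorem rename_mem_supp_size (w : Equiv.Perm (Fin n)) (P : ℕ → Prop)
    {f : MvPolynomial (Fin n) R} (hf : f ∈ supp R fun γ => P (size γ)) :
    rename w f ∈ supp R fun γ => P (size γ) := by
  refine map_mem_supp (rename w).toLinearMap (fun γ hγ => ?_) hf
  rw [AlgHom.toLinearMap_apply, rename_mon]
  exact mon_mem_supp (by rwa [size_comp])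

theorem coeff_scale (c : BaseField) (f : PolyRing n) (γ : Fin n →₀ ℕ) :
    coeff γ (scale c f) = c ^ size γ * coeff γ f := by
  induction f using MvPolynomial.induction_on' with
  | monomial δ a =>
    have h : scale c (monomial δ a) = monomial δ (c ^ size δ * a) := by
      rw [monomial_eq_smul_mon, monomial_eq_smul_mon, smul_eq_C_mul, smul_eq_C_mul]
      simp only [scale, mon_eq_prod, map_mul, map_prod, map_pow, bind₁_X_right, mul_pow,
        Finset.prod_mul_distrib, Finset.prod_pow_eq_pow_sum, size, bind₁_C_right]
      ring
    rw [h, coeff_monomial, coeff_monomial]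
    split_ifs with hδ
    · rw [hδ]
    · rw [mul_zero]
  | add f g hf hg =>
    rw [coeff_add, mul_add, ← hf, ← hg, ← coeff_add, scale, map_add]
    rfl

theorem dual_mem_supp {P : (Fin n → ℕ) → Prop} {f : PolyRing n} (hf : f ∈ supp BaseField P) :
    dual f ∈ supp BaseField P := by
  refine mem_supp.2 fun γ hγ => mem_supp.1 hf γ fun h => hγ ?_
  rw [dual_apply, coeff_scale, circ, coeff_map, h, map_zero, mul_zero]

theorem dual_eq_C_mul_circ {f : PolyRing n} (hf : f ∈ degreeEq BaseField n d) :
    dual f = C ((t ^ ((n : ℤ) - 1)) ^ d) * circ f := by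
  ext γ
  rw [dual_apply, coeff_scale, coeff_C_mul, circ, coeff_map]
  by_cases h : coeff γ f = 0
  · rw [h, map_zero, mul_zero, mul_zero]
  · rw [mem_supp.1 hf γ h]

end Degree

section DemLusMonomial

variable {σ R : Type*}

/-- `γ'` lies on the segment from `γ` to its image under the interchange of the entries at `a`
and `b`. -/
def InString (a b : σ) (γ γ' : σ → ℕ) : Prop :=
  (∀ u, u ≠ a → u ≠ b → γ' u = γ u) ∧ γ' a + γ' b = γ a + γ b ∧
    min (γ a) (γ b) ≤ γ' a ∧ min (γ a) (γ b) ≤ γ' b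

variable {a b : σ}

theorem inString_refl (a b : σ) (γ : σ → ℕ) : InString a b γ γ :=
  ⟨fun _ _ _ => rfl, rfl, min_le_left _ _, min_le_right _ _⟩

theorem sum_eq_add_pair [Fintype σ] [DecidableEq σ] (hab : a ≠ b) (g : σ → ℕ) :
    ∑ u, g u = g a + g b + ∑ u ∈ {a, b}ᶜ, g u := by
  rw [← Finset.sum_pair hab, Finset.sum_add_sum_compl]

theorem InString.sum_eq [Fintype σ] (hab : a ≠ b) {γ γ' : σ → ℕ} (h : InString a b γ γ') :
    ∑ u, γ' u = ∑ u, γ u := by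
  classical
  rw [sum_eq_add_pair hab, sum_eq_add_pair hab, h.2.1]
  congr 1
  refine Finset.sum_congr rfl fun u hu => ?_
  rw [Finset.mem_compl, Finset.mem_insert, Finset.mem_singleton, not_or] at hu
  exact h.1 u hu.1 hu.2

variable [DecidableEq σ]

theorem inString_comp_swap (a b : σ) (γ : σ → ℕ) : InString a b γ (γ ∘ Equiv.swap a b) := by
  refine ⟨fun u ha hb => ?_, ?_, ?_, ?_⟩
  · rw [Function.comp_apply, Equiv.swap_apply_of_ne_of_ne ha hb]
  all_goals simp [add_comm]

theorem InString.of_comp_swap {γ γ' : σ → ℕ} (h : InString a b (γ ∘ Equiv.swap a b) γ') :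
    InString a b γ γ' := by
  obtain ⟨hne, hadd, hle⟩ := h
  simp only [Function.comp_apply, Equiv.swap_apply_left, Equiv.swap_apply_right] at hadd hle
  refine ⟨fun u ha hb => ?_, hadd.trans (add_comm _ _), by rwa [min_comm]⟩
  rw [hne u ha hb, Function.comp_apply, Equiv.swap_apply_of_ne_of_ne ha hb]

/-- The function that agrees with `γ` except for the values `x` at `a` and `y` at `b`. -/
def setPair (a b : σ) (γ : σ → ℕ) (x y : ℕ) : σ → ℕ :=
  Function.update (Function.update γ a x) b y

theorem setPair_left (hab : a ≠ b) (γ : σ → ℕ) (x y : ℕ) : setPair a b γ x y a = x := by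
  simp [setPair, hab]

theorem setPair_right (γ : σ → ℕ) (x y : ℕ) : setPair a b γ x y b = y := by
  simp [setPair]

theorem setPair_of_ne {u : σ} (ha : u ≠ a) (hb : u ≠ b) (γ : σ → ℕ) (x y : ℕ) :
    setPair a b γ x y u = γ u := by
  simp [setPair, ha, hb]

theorem setPair_self (a b : σ) (γ : σ → ℕ) : setPair a b γ (γ a) (γ b) = γ := by
  simp [setPair]

variable [Finite σ] [CommRing R]

theorem mon_setPair (hab : a ≠ b) (γ : σ → ℕ) (c x y : ℕ) :
    (mon (setPair a b γ (c + x) (c + y)) : MvPolynomial σ R) =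
      mon (setPair a b γ c c) * (X a ^ x * X b ^ y) := by
  rw [← mon_single, ← mon_single, ← mon_add, ← mon_add]
  congr 1
  funext u
  rcases eq_or_ne u a with rfl | ha
  · simp [setPair_left, hab]
  rcases eq_or_ne u b with rfl | hb
  · simp [setPair_right, ha]
  · simp [setPair_of_ne, ha, hb]

variable [IsDomain R]

theorem X_mul_divDiff_mon (hab : a ≠ b) {γ : σ → ℕ} {k : ℕ} (h : γ a = γ b + k) :
    (X a * divDiff a b (mon γ) : MvPolynomial σ R) =
      ∑ l ∈ Finset.range k, mon (setPair a b γ (γ b + (l + 1)) (γ b + (k - 1 - l))) := by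
  set δ := setPair a b γ (γ b) (γ b) with hδ
  have hsymm : δ ∘ (Equiv.swap a b).symm = δ := by
    funext u
    rw [Equiv.symm_swap, Function.comp_apply]
    rcases eq_or_ne u a with rfl | ha
    · simp [hδ, setPair_left hab, setPair_right]
    rcases eq_or_ne u b with rfl | hb
    · simp [hδ, setPair_left hab, setPair_right]
    · rw [Equiv.swap_apply_of_ne_of_ne ha hb]
  have hγ : (mon γ : MvPolynomial σ R) = mon δ * X a ^ k := by
    rw [← mul_one (X a ^ k), ← pow_zero (X b), hδ, ← mon_setPair hab, ← h, add_zero, setPair_self]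
  have hp : rename (Equiv.swap a b) (mon δ : MvPolynomial σ R) = mon δ := by
    rw [rename_mon, hsymm]
  simp only [hγ, divDiff_mul_X_pow hab hp, mon_setPair hab, ← hδ, Finset.mul_sum]
  exact Finset.sum_congr rfl fun l _ => by ring

theorem X_mul_divDiff_mon_mem (hab : a ≠ b) (γ : σ → ℕ) :
    X a * divDiff a b (mon γ) ∈ supp R (InString a b γ) := by
  wlog hle : γ b ≤ γ a generalizing γ
  · have hswap := this (γ ∘ Equiv.swap a b) (by simpa using (not_le.1 hle).le)
    rw [← Equiv.symm_swap, ← rename_mon, Equiv.symm_swap, divDiff_rename_swap, mul_neg,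
      Submodule.neg_mem_iff] at hswap
    exact supp_mono (fun _ => InString.of_comp_swap) hswap
  obtain ⟨k, hk⟩ := Nat.exists_eq_add_of_le hle
  rw [X_mul_divDiff_mon hab hk]
  refine Submodule.sum_mem _ fun l hl => mon_mem_supp ?_
  rw [Finset.mem_range] at hl
  refine ⟨fun u ha hb => setPair_of_ne ha hb _ _ _, ?_⟩
  rw [setPair_left hab, setPair_right]
  omega

theorem demLus_mon_mem (s : R) (hab : a ≠ b) (γ : σ → ℕ) :
    demLus s a b (mon γ) ∈ supp R (InString a b γ) := by
  rw [demLus_apply, rename_mon, Equiv.symm_swap]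
  exact Submodule.sub_mem _ (C_mul_mem_supp _ (mon_mem_supp (inString_comp_swap a b γ)))
    (C_mul_mem_supp _ (X_mul_divDiff_mon_mem hab γ))

theorem coeff_X_mul_divDiff_mon {γ : σ → ℕ} (h : γ b < γ a) :
    coeff (Finsupp.equivFunOnFinite.symm γ) (X a * divDiff a b (mon γ) : MvPolynomial σ R) =
      1 := by
  have hab : a ≠ b := by
    rintro rfl
    exact lt_irrefl _ h
  obtain ⟨k, hk⟩ := Nat.exists_eq_add_of_lt h
  have hself : setPair a b γ (γ b + (k + 1)) (γ b + (k + 1 - 1 - k)) = γ := by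
    rw [← add_assoc, ← hk, Nat.add_sub_cancel, Nat.sub_self, add_zero, setPair_self]
  rw [X_mul_divDiff_mon hab (k := k + 1) hk, coeff_sum, Finset.sum_eq_single k, hself,
    coeff_mon_self]
  · intro l _ hl
    refine coeff_eq_zero_of_mem_supp (mon_mem_supp (P := fun δ => δ a ≠ γ a) ?_) fun hne => hne rfl
    rw [setPair_left hab]
    omega
  · simp

theorem coeff_demLus_mon (s : R) {γ : σ → ℕ} (h : γ a < γ b) :
    coeff (Finsupp.equivFunOnFinite.symm (γ ∘ Equiv.swap a b)) (demLus s a b (mon γ)) = 1 := by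
  have hdiv : coeff (Finsupp.equivFunOnFinite.symm (γ ∘ Equiv.swap a b))
      (X a * divDiff a b (mon γ) : MvPolynomial σ R) = -1 := by
    have hswap := coeff_X_mul_divDiff_mon (R := R) (a := a) (b := b) (γ := γ ∘ Equiv.swap a b)
      (by simpa using h)
    have hmon : (mon (γ ∘ Equiv.swap a b) : MvPolynomial σ R) =
        rename (Equiv.swap a b) (mon γ) := by
      rw [rename_mon, Equiv.symm_swap]
    rwa [hmon, divDiff_rename_swap, mul_neg, coeff_neg, neg_eq_iff_eq_neg] at hswap
  rw [demLus_apply, rename_mon, Equiv.symm_swap, coeff_sub, coeff_C_mul, coeff_C_mul,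
    coeff_mon_self, hdiv]
  ring

end DemLusMonomial

section DemLusDegree

variable {n : ℕ} {R : Type*} [CommRing R] [IsDomain R]

theorem demLus_mem_supp_size (s : R) {a b : Fin n} (hab : a ≠ b) (P : ℕ → Prop)
    {f : MvPolynomial (Fin n) R} (hf : f ∈ supp R fun γ => P (size γ)) :
    demLus s a b f ∈ supp R fun γ => P (size γ) := by
  refine map_mem_supp (demLus s a b) (fun γ hγ => ?_) hf
  refine supp_mono (fun γ' h => ?_) (demLus_mon_mem s hab γ)
  rwa [size, h.sum_eq hab]

theorem demLusWord_mem_supp_size (s : R) (l : List (Fin (n - 1))) (P : ℕ → Prop)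
    {f : MvPolynomial (Fin n) R} (hf : f ∈ supp R fun γ => P (size γ)) :
    demLusWord s l f ∈ supp R fun γ => P (size γ) := by
  induction l with
  | nil => exact hf
  | cons i l ih =>
    rw [demLusWord_cons]
    exact demLus_mem_supp_size s (lo_ne_hi i) P ih

end DemLusDegree

section Order

variable {n : ℕ}

/-- The number of boxes beyond column `m` in the diagram of `γ` with its first `j` rows extended by
one box. -/
def ramp (m j : ℕ) (γ : Fin n → ℕ) : ℕ := ∑ u : Fin n, (γ u + (if (u : ℕ) < j then 1 else 0) - m)

/-- The partial order for which the top homogeneous parts of the interpolation polynomials are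
triangular. It compares all the numbers `ramp m j`, so that it is preserved both by `s_i` and by
the affine step `(a, β) ↦ (β, a + 1)`. -/
def Below (γ α : Fin n → ℕ) : Prop := size γ = size α ∧ ∀ m j, ramp m j γ ≤ ramp m j α

/-- The contribution to `ramp` of the rows other than `i` and `i + 1`. -/
def rampRest (m j : ℕ) (i : Fin (n - 1)) (γ : Fin n → ℕ) : ℕ :=
  ∑ u ∈ {lo i, hi i}ᶜ, (γ u + (if (u : ℕ) < j then 1 else 0) - m)

theorem ramp_eq (m j : ℕ) (i : Fin (n - 1)) (γ : Fin n → ℕ) :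
    ramp m j γ = (γ (lo i) + (if (i : ℕ) < j then 1 else 0) - m) +
      (γ (hi i) + (if (i : ℕ) + 1 < j then 1 else 0) - m) + rampRest m j i γ :=
  sum_eq_add_pair (lo_ne_hi i) _

theorem rampRest_congr (m j : ℕ) {i : Fin (n - 1)} {γ γ' : Fin n → ℕ}
    (h : ∀ u, u ≠ lo i → u ≠ hi i → γ u = γ' u) : rampRest m j i γ = rampRest m j i γ' := by
  refine Finset.sum_congr rfl fun u hu => ?_
  rw [Finset.mem_compl, Finset.mem_insert, Finset.mem_singleton, not_or] at hu
  rw [h u hu.1 hu.2]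

theorem rampRest_eq_of_near (m : ℕ) {j : ℕ} {i : Fin (n - 1)} (hij : (i : ℕ) ≤ j)
    (hji : j ≤ i + 2) (γ : Fin n → ℕ) : rampRest m j i γ = rampRest m (i + 1) i γ := by
  refine Finset.sum_congr rfl fun u hu => ?_
  simp only [Finset.mem_compl, Finset.mem_insert, Finset.mem_singleton, not_or, lo, hi,
    Fin.ext_iff] at hu
  have hiff : (u : ℕ) < j ↔ (u : ℕ) < i + 1 := by omega
  simp only [hiff]

theorem below_comp_simple {i : Fin (n - 1)} {α γ γ' : Fin n → ℕ} (h : α (lo i) < α (hi i))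
    (hγ : Below γ α) (hs : InString (lo i) (hi i) γ γ') : Below γ' (α ∘ simple i) := by
  refine ⟨by rw [size_comp, ← hγ.1, size, hs.sum_eq (lo_ne_hi i), size], fun m j => ?_⟩
  obtain ⟨hne, hadd, hlo, hhi⟩ := hs
  have hα : rampRest m j i (α ∘ simple i) = rampRest m j i α :=
    rampRest_congr m j fun u hulo huhi => congrArg α (simple_of_ne hulo huhi)
  rw [ramp_eq m j i, ramp_eq m j i, hα, rampRest_congr m j hne, Function.comp_apply,
    Function.comp_apply, simple_lo, simple_hi]
  by_cases hj : j = i + 1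
  · subst hj
    have hprev := hγ.2 m i
    have hnext := hγ.2 m (i + 2)
    have hfirst := rampRest_eq_of_near m (i := i) le_rfl (Nat.le_add_right _ _)
    have hlast := rampRest_eq_of_near m (i := i) (Nat.le_add_right _ _) le_rfl
    rw [ramp_eq m i i, ramp_eq m i i, hfirst, hfirst] at hprev
    rw [ramp_eq m _ i, ramp_eq m _ i, hlast, hlast] at hnext
    simp only [lt_self_iff_false, not_lt_of_ge (Nat.le_succ (i : ℕ)), Nat.lt_succ_self,
      Nat.lt_add_of_pos_right Nat.two_pos, if_true, if_false] at hprev hnext ⊢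
    omega
  · have hγj := hγ.2 m j
    have hiff : (i : ℕ) + 1 < j ↔ (i : ℕ) < j := by omega
    rw [ramp_eq m j i, ramp_eq m j i] at hγj
    simp only [hiff] at hγj ⊢
    split_ifs at hγj ⊢ <;> omega

theorem eq_of_below_of_inString {i : Fin (n - 1)} {α γ : Fin n → ℕ} (h : α (lo i) < α (hi i))
    (hγ : Below γ α) (hs : InString (lo i) (hi i) γ (α ∘ simple i)) : γ = α := by
  obtain ⟨hne, hadd, hlo, hhi⟩ := hs
  rw [Function.comp_apply, Function.comp_apply, simple_lo, simple_hi] at hadd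
  rw [Function.comp_apply, simple_lo] at hlo
  rw [Function.comp_apply, simple_hi] at hhi
  have hoff : ∀ u, u ≠ lo i → u ≠ hi i → γ u = α u := fun u hulo huhi => by
    rw [← hne u hulo huhi, Function.comp_apply, simple_of_ne hulo huhi]
  have hprev := hγ.2 (α (hi i)) i
  have hmid := hγ.2 (α (hi i)) (i + 1)
  rw [ramp_eq _ _ i, ramp_eq _ _ i, rampRest_congr _ _ hoff] at hprev hmid
  simp only [lt_self_iff_false, not_lt_of_ge (Nat.le_succ (i : ℕ)), Nat.lt_succ_self, if_true,
    if_false] at hprev hmid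
  have hpair : γ (lo i) = α (lo i) ∧ γ (hi i) = α (hi i) := by omega
  funext u
  by_cases hulo : u = lo i
  · rw [hulo, hpair.1]
  by_cases huhi : u = hi i
  · rw [huhi, hpair.2]
  exact hoff u hulo huhi

theorem not_below_comp_simple {i : Fin (n - 1)} {α : Fin n → ℕ} (h : α (lo i) < α (hi i)) :
    ¬Below (α ∘ simple i) α := by
  intro hb
  have heq := congrFun (eq_of_below_of_inString h hb (inString_refl _ _ _)) (lo i)
  rw [Function.comp_apply, simple_lo] at heq
  exact h.ne' heq

theorem ramp_snoc_succ_of_le (m : ℕ) {j : ℕ} (hj : j ≤ n) (a : ℕ) (β : Fin n → ℕ) :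
    ramp m j (Fin.snoc β (a + 1) : Fin (n + 1) → ℕ) =
      ramp m (j + 1) (Fin.cons a β : Fin (n + 1) → ℕ) := by
  rw [ramp, ramp, Fin.sum_univ_castSucc, Fin.sum_univ_succ]
  simp [hj.not_gt, add_comm]

theorem ramp_snoc_succ_of_lt (m : ℕ) {j : ℕ} (hj : n < j) (a : ℕ) (β : Fin n → ℕ) :
    ramp (m + 1) j (Fin.snoc β (a + 1) : Fin (n + 1) → ℕ) =
      ramp m 1 (Fin.cons a β : Fin (n + 1) → ℕ) := by
  have hlt (u : Fin n) : (u : ℕ) < j := u.2.trans hj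
  rw [ramp, ramp, Fin.sum_univ_castSucc, Fin.sum_univ_succ]
  simp only [hlt, hj, Fin.snoc_castSucc, Fin.snoc_last, Fin.val_castSucc, Fin.val_last,
    Fin.cons_zero, Fin.cons_succ, Fin.val_zero, Fin.val_succ, if_true, Nat.lt_one_iff,
    Nat.succ_ne_zero, if_false, Nat.add_sub_add_right, Nat.add_zero]
  rw [add_comm]

theorem ramp_zero (j : ℕ) (γ : Fin n → ℕ) :
    ramp 0 j γ = size γ + ∑ u : Fin n, (if (u : ℕ) < j then 1 else 0) := by
  rw [ramp, size, ← Finset.sum_add_distrib]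
  rfl

theorem below_snoc_succ {a c : ℕ} {β γ : Fin n → ℕ}
    (h : Below (Fin.cons c γ : Fin (n + 1) → ℕ) (Fin.cons a β)) :
    Below (Fin.snoc γ (c + 1) : Fin (n + 1) → ℕ) (Fin.snoc β (a + 1)) := by
  have hsize : size (Fin.snoc γ (c + 1) : Fin (n + 1) → ℕ) = size (Fin.snoc β (a + 1)) := by
    have hcons := h.1
    rw [size_cons, size_cons] at hcons
    rw [size_snoc, size_snoc]
    omega
  refine ⟨hsize, fun m j => ?_⟩
  rcases le_or_gt j n with hj | hj
  · rw [ramp_snoc_succ_of_le m hj, ramp_snoc_succ_of_le m hj]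
    exact h.2 m (j + 1)
  · rcases m with _ | m
    · rw [ramp_zero, ramp_zero, hsize]
    · rw [ramp_snoc_succ_of_lt m hj, ramp_snoc_succ_of_lt m hj]
      exact h.2 m 1

variable {R : Type*} [CommRing R]

theorem mem_below_comp_simple {i : Fin (n - 1)} {α : Fin n → ℕ} (h : α (lo i) < α (hi i))
    {E : MvPolynomial (Fin n) R} (hE : E ∈ supp R (Below · α)) :
    E ∈ supp R (Below · (α ∘ simple i)) :=
  supp_mono (fun _ hγ => below_comp_simple h hγ (inString_refl _ _ _)) hE

variable [IsDomain R]

theorem demLus_mem_below (s : R) {i : Fin (n - 1)} {α : Fin n → ℕ} (h : α (lo i) < α (hi i))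
    {E : MvPolynomial (Fin n) R} (hE : E ∈ supp R (Below · α)) :
    demLus s (lo i) (hi i) E ∈ supp R (Below · (α ∘ simple i)) :=
  map_mem_supp (demLus s (lo i) (hi i)) (fun γ hγ =>
    supp_mono (fun _ hs => below_comp_simple h hγ hs) (demLus_mon_mem s (lo_ne_hi i) γ)) hE

theorem coeff_demLus_of_mem_below (s : R) {i : Fin (n - 1)} {α : Fin n → ℕ}
    (h : α (lo i) < α (hi i)) {E : MvPolynomial (Fin n) R} (hE : E ∈ supp R (Below · α)) :
    coeff (Finsupp.equivFunOnFinite.symm (α ∘ simple i)) (demLus s (lo i) (hi i) E) =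
      coeff (Finsupp.equivFunOnFinite.symm α) E := by
  rw [coeff_map_of_mem_supp _ (fun γ hγ hne => ?_) hE, simple, coeff_demLus_mon s h, mul_one]
  refine supp_mono (fun γ' hs => ?_) (demLus_mon_mem s (lo_ne_hi i) γ)
  rintro rfl
  exact hne (eq_of_below_of_inString h hγ hs)

end Order

section Shift

variable {n : ℕ} {R : Type*} [CommRing R]

/-- The operator `f ↦ f(c x_n, x_1, …, x_(n-1))`; it raises interpolation polynomials for
`c = q⁻¹`. -/
def shift (c : R) : MvPolynomial (Fin (n + 1)) R →ₐ[R] MvPolynomial (Fin (n + 1)) R :=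
  bind₁ (Fin.cons (C c * X (Fin.last n)) fun k => X k.castSucc)

/-- The operator `f ↦ f(x_2, …, x_n, c x_1)`, inverse to `shift c⁻¹`. -/
def unshift (c : R) : MvPolynomial (Fin (n + 1)) R →ₐ[R] MvPolynomial (Fin (n + 1)) R :=
  bind₁ (Fin.snoc (fun k => X k.succ) (C c * X 0))

@[simp] theorem shift_X_zero (c : R) :
    shift c (X 0 : MvPolynomial (Fin (n + 1)) R) = C c * X (Fin.last n) := by
  simp [shift]

@[simp] theorem shift_X_succ (c : R) (k : Fin n) : shift c (X k.succ) = X k.castSucc := by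
  simp [shift]

@[simp] theorem unshift_X_last (c : R) :
    unshift c (X (Fin.last n) : MvPolynomial (Fin (n + 1)) R) = C c * X 0 := by
  simp [unshift]

@[simp] theorem unshift_X_castSucc (c : R) (k : Fin n) : unshift c (X k.castSucc) = X k.succ := by
  simp [unshift]

theorem unshift_shift {c c' : R} (hc : c * c' = 1) (f : MvPolynomial (Fin (n + 1)) R) :
    unshift c (shift c' f) = f := by
  have h : (unshift c).comp (shift c') = AlgHom.id R (MvPolynomial (Fin (n + 1)) R) := by
    ext1 k
    refine Fin.cases ?_ (fun k => ?_) k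
    · rw [AlgHom.comp_apply, shift_X_zero, map_mul, algHom_C, unshift_X_last, algebraMap_eq,
        ← mul_assoc, ← C_mul, mul_comm, mul_comm c', hc, C_1, mul_one, AlgHom.id_apply]
    · rw [AlgHom.comp_apply, shift_X_succ, unshift_X_castSucc, AlgHom.id_apply]
  exact AlgHom.congr_fun h f

theorem shift_unshift {c c' : R} (hc : c * c' = 1) (f : MvPolynomial (Fin (n + 1)) R) :
    shift c (unshift c' f) = f := by
  have h : (shift c).comp (unshift c') = AlgHom.id R (MvPolynomial (Fin (n + 1)) R) := by
    ext1 k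
    refine Fin.lastCases ?_ (fun k => ?_) k
    · rw [AlgHom.comp_apply, unshift_X_last, map_mul, algHom_C, shift_X_zero, algebraMap_eq,
        ← mul_assoc, ← C_mul, mul_comm, mul_comm c', hc, C_1, mul_one, AlgHom.id_apply]
    · rw [AlgHom.comp_apply, unshift_X_castSucc, shift_X_succ, AlgHom.id_apply]
  exact AlgHom.congr_fun h f

theorem eval_shift (c : R) (v : Fin (n + 1) → R) (f : MvPolynomial (Fin (n + 1)) R) :
    eval v (shift c f) = eval (Fin.cons (c * v (Fin.last n)) fun k => v k.castSucc) f := by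
  refine (eval₂Hom_bind₁ _ _ _ _).trans (congrArg (eval · f) (funext fun k => ?_))
  refine Fin.cases ?_ (fun k => ?_) k <;> simp

theorem shift_mem_degreeLT (c : R) {d : ℕ} {f : MvPolynomial (Fin (n + 1)) R}
    (hf : f ∈ degreeLT R (n + 1) d) : shift c f ∈ degreeLT R (n + 1) d := by
  refine bind₁_mem_degreeLT (fun k => ?_) hf
  refine Fin.cases ?_ (fun k => ?_) k
  · rw [Fin.cons_zero]
    exact totalDegree_C_mul_X_le c _
  · rw [Fin.cons_succ]
    exact totalDegree_X_le _

theorem unshift_mem_degreeLT (c : R) {d : ℕ} {f : MvPolynomial (Fin (n + 1)) R}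
    (hf : f ∈ degreeLT R (n + 1) d) : unshift c f ∈ degreeLT R (n + 1) d := by
  refine bind₁_mem_degreeLT (fun k => ?_) hf
  refine Fin.lastCases ?_ (fun k => ?_) k
  · rw [Fin.snoc_last]
    exact totalDegree_C_mul_X_le c _
  · rw [Fin.snoc_castSucc]
    exact totalDegree_X_le _

theorem X_last_mul_shift_mon (c : R) (a : ℕ) (γ : Fin n → ℕ) :
    X (Fin.last n) * shift c (mon (Fin.cons a γ)) = C (c ^ a) * mon (Fin.snoc γ (a + 1)) := by
  rw [mon_eq_prod, mon_eq_prod, map_prod, Fin.prod_univ_succ, Fin.prod_univ_castSucc]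
  simp only [map_pow, shift_X_zero, shift_X_succ, Fin.cons_zero, Fin.cons_succ, Fin.snoc_castSucc,
    Fin.snoc_last, mul_pow]
  ring

theorem X_last_mul_shift_mem_supp (c : R) {P Q : (Fin (n + 1) → ℕ) → Prop}
    (h : ∀ a γ, P (Fin.cons a γ) → Q (Fin.snoc γ (a + 1))) {f : MvPolynomial (Fin (n + 1)) R}
    (hf : f ∈ supp R P) : X (Fin.last n) * shift c f ∈ supp R Q := by
  refine map_mem_supp (LinearMap.mulLeft R (X (Fin.last n)) ∘ₗ (shift c).toLinearMap)
    (fun γ hγ => ?_) hf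
  rw [← Fin.cons_self_tail γ] at hγ ⊢
  rw [LinearMap.comp_apply, AlgHom.toLinearMap_apply, LinearMap.mulLeft_apply,
    X_last_mul_shift_mon]
  exact C_mul_mem_supp _ (mon_mem_supp (h _ _ hγ))

theorem X_last_mul_shift_mem_degreeEq (c : R) {d : ℕ} {f : MvPolynomial (Fin (n + 1)) R}
    (hf : f ∈ degreeEq R (n + 1) d) : X (Fin.last n) * shift c f ∈ degreeEq R (n + 1) (d + 1) :=
  X_last_mul_shift_mem_supp c (fun a γ hγ => by rw [size_cons] at hγ; rw [size_snoc]; omega) hf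

theorem coeff_X_last_mul_shift (c : R) (a : ℕ) (β : Fin n → ℕ)
    (f : MvPolynomial (Fin (n + 1)) R) :
    coeff (Finsupp.equivFunOnFinite.symm (Fin.snoc β (a + 1))) (X (Fin.last n) * shift c f) =
      c ^ a * coeff (Finsupp.equivFunOnFinite.symm (Fin.cons a β)) f := by
  have hmon (γ : Fin (n + 1) → ℕ) (hγ : γ ≠ Fin.cons a β) :
      X (Fin.last n) * shift c (mon γ) ∈ supp R (· ≠ Fin.snoc β (a + 1)) := by
    refine X_last_mul_shift_mem_supp c (P := (· ≠ Fin.cons a β)) (fun b δ hne heq => hne ?_)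
      (mon_mem_supp hγ)
    obtain ⟨rfl, hb⟩ := Fin.snoc_injective2 heq
    rw [Nat.succ_injective hb]
  have h := coeff_map_of_mem_supp (P := fun _ => True)
    (LinearMap.mulLeft R (X (Fin.last n)) ∘ₗ (shift c).toLinearMap) (fun γ _ => hmon γ)
    (mem_supp.2 fun _ _ => trivial : f ∈ _)
  refine h.trans ?_
  rw [LinearMap.comp_apply, AlgHom.toLinearMap_apply, LinearMap.mulLeft_apply,
    X_last_mul_shift_mon, coeff_C_mul, coeff_mon_self, mul_one, mul_comm]

end Shift

section Vanishing

variable {n : ℕ} {R : Type*} [CommRing R]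

/-- The polynomial `f(x_1, …, x_(n-1), c)`. -/
def restrictLast (c : R) : MvPolynomial (Fin (n + 1)) R →ₐ[R] MvPolynomial (Fin n) R :=
  bind₁ (Fin.snoc X (C c))

theorem eval_restrictLast (c : R) (v : Fin n → R) (f : MvPolynomial (Fin (n + 1)) R) :
    eval v (restrictLast c f) = eval (Fin.snoc v c) f := by
  refine (eval₂Hom_bind₁ _ _ _ _).trans (congrArg (eval · f) (funext fun k => ?_))
  refine Fin.lastCases ?_ (fun k => ?_) k <;> simp

theorem restrictLast_mem_degreeLT (c : R) {d : ℕ} {f : MvPolynomial (Fin (n + 1)) R}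
    (hf : f ∈ degreeLT R (n + 1) d) : restrictLast c f ∈ degreeLT R n d := by
  refine bind₁_mem_degreeLT (fun k => ?_) hf
  refine Fin.lastCases ?_ (fun k => ?_) k
  · simp
  · rw [Fin.snoc_castSucc]
    exact totalDegree_X_le _

theorem X_last_sub_C_dvd {c : R} {f : MvPolynomial (Fin (n + 1)) R} (h : restrictLast c f = 0) :
    X (Fin.last n) - C c ∣ f := by
  have hdvd := dvd_sub_map_of_forall_dvd_X_sub (p := X (Fin.last n) - C c)
    ((rename Fin.castSucc).comp (restrictLast c))
    (fun k => by refine Fin.lastCases ?_ (fun k => ?_) k <;> simp [restrictLast]) f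
  rwa [AlgHom.comp_apply, h, map_zero, sub_zero] at hdvd

theorem eval_point_shift (a : ℕ) (β : Fin n → ℕ) (f : PolyRing (n + 1)) :
    eval (point (Fin.snoc β (a + 1))) (shift q⁻¹ f) = eval (point (Fin.cons a β)) f := by
  rw [eval_shift]
  congr 2
  funext k
  refine Fin.cases ?_ (fun k => ?_) k
  · rw [Fin.cons_zero, point_snoc_succ_last, inv_mul_cancel_left₀ q_ne_zero]
  · rw [Fin.cons_succ, point_snoc_succ_castSucc]

theorem eq_zero_of_vanishing {n d : ℕ} {f : PolyRing n} (hf : f ∈ degreeLT BaseField n d)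
    (h : ∀ β, size β < d → eval (point β) f = 0) : f = 0 := by
  induction n generalizing d with
  | zero =>
    rcases d with _ | d
    · exact eq_zero_of_mem_degreeLT_zero hf
    · have hconst := h Fin.elim0 (by simp [size])
      rw [eq_C_of_isEmpty f, eval_C] at hconst
      rw [eq_C_of_isEmpty f, hconst, C_0]
  | succ n ih_n =>
    induction d generalizing f with
    | zero => exact eq_zero_of_mem_degreeLT_zero hf
    | succ d ih_d =>
      have hrestrict : restrictLast (t ^ (-(n : ℤ))) f = 0 := by
        refine ih_n (restrictLast_mem_degreeLT _ hf) fun β hβ => ?_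
        rw [eval_restrictLast, ← point_snoc_zero]
        exact h _ (by rwa [size_snoc])
      obtain ⟨g, rfl⟩ := X_last_sub_C_dvd hrestrict
      have hg : unshift q g = 0 := by
        refine ih_d (unshift_mem_degreeLT q (mem_degreeLT_of_X_sub_C_mul_mem hf)) fun γ hγ => ?_
        rw [← Fin.cons_self_tail γ] at hγ ⊢
        rw [size_cons] at hγ
        have hv := h (Fin.snoc (Fin.tail γ) (γ 0 + 1)) (by rw [size_snoc]; omega)
        rw [eval_mul, eval_sub, eval_X, eval_C] at hv
        rw [← eval_point_shift, shift_unshift (inv_mul_cancel₀ q_ne_zero)]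
        exact (mul_eq_zero.1 hv).resolve_left (sub_ne_zero.2 (point_snoc_succ_last_ne _ _))
      rw [← shift_unshift (inv_mul_cancel₀ q_ne_zero) g, hg, map_zero, mul_zero]

end Vanishing

section Interpolation

variable {n : ℕ} {α : Fin n → ℕ}

theorem IsInterpolation.mem_degreeLT {G : PolyRing n} (h : IsInterpolation α G) :
    G ∈ degreeLT BaseField n (size α + 1) :=
  mem_degreeLT_succ.2 h.degree_le

theorem IsInterpolation.eval_point_ne_zero {G : PolyRing n} (h : IsInterpolation α G) :
    eval (point α) G ≠ 0 := by
  intro hα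
  have hG : G = 0 := by
    refine eq_zero_of_vanishing h.mem_degreeLT fun β hβ => ?_
    rcases eq_or_ne β α with rfl | hβα
    · exact hα
    · exact h.vanishing β (Nat.lt_succ_iff.1 hβ) hβα
  simpa [hG] using h.coeff_eq_one

theorem IsInterpolation.eq_C_mul {G F : PolyRing n} (h : IsInterpolation α G)
    (hF : F ∈ degreeLT BaseField n (size α + 1))
    (hv : ∀ β, size β ≤ size α → β ≠ α → eval (point β) F = 0) :
    F = C (eval (point α) F / eval (point α) G) * G := by
  rw [← sub_eq_zero]
  refine eq_zero_of_vanishing (Submodule.sub_mem _ hF (C_mul_mem_supp _ h.mem_degreeLT))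
    fun β hβ => ?_
  rw [eval_sub, eval_mul, eval_C]
  rcases eq_or_ne β α with rfl | hβα
  · rw [div_mul_cancel₀ _ h.eval_point_ne_zero, sub_self]
  · have hG : eval (point β) G = 0 := h.vanishing β (Nat.lt_succ_iff.1 hβ) hβα
    rw [hv β (Nat.lt_succ_iff.1 hβ) hβα, hG, mul_zero, sub_zero]

theorem IsInterpolation.unique {F G : PolyRing n} (hF : IsInterpolation α F)
    (hG : IsInterpolation α G) : F = G := by
  have heq := hG.eq_C_mul hF.mem_degreeLT hF.vanishing
  have hcoeff := hF.coeff_eq_one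
  rw [heq, coeff_C_mul, hG.coeff_eq_one, mul_one] at hcoeff
  rw [heq, hcoeff, C_1, one_mul]

theorem eval_point_demLus_of_ne (s : BaseField) {i : Fin (n - 1)} {β : Fin n → ℕ} {f : PolyRing n}
    (h : β (lo i) ≠ β (hi i)) (hβ : eval (point β) f = 0)
    (hβi : eval (point (β ∘ simple i)) f = 0) :
    eval (point β) (demLus s (lo i) (hi i) f) = 0 := by
  have heval := mul_eval_demLus s (lo i) (hi i) (point β) f
  rw [point_comp_simple h, simple] at hβi
  rw [hβ, hβi, mul_zero, mul_zero, sub_zero] at heval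
  exact (mul_eq_zero.1 heval).resolve_left (sub_ne_zero.2 (point_lo_ne_point_hi β i))

theorem eval_point_demLus_of_eq {i : Fin (n - 1)} {β : Fin n → ℕ} {f : PolyRing n}
    (h : β (lo i) = β (hi i)) (hβ : eval (point β) f = 0) :
    eval (point β) (demLus t (lo i) (hi i) f) = 0 := by
  have heval := mul_eval_demLus t (lo i) (hi i) (point β) f
  rw [hβ, point_lo_eq_mul_point_hi h, sub_self, zero_mul, mul_zero, sub_zero,
    ← point_lo_eq_mul_point_hi h] at heval
  exact (mul_eq_zero.1 heval).resolve_left (sub_ne_zero.2 (point_lo_ne_point_hi β i))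

theorem eval_point_demLusWord {d : ℕ} {f : PolyRing n}
    (h : ∀ β, size β < d → eval (point β) f = 0) (l : List (Fin (n - 1))) {β : Fin n → ℕ}
    (hβ : size β < d) : eval (point β) (demLusWord t l f) = 0 := by
  induction l generalizing β with
  | nil => exact h β hβ
  | cons i l ih =>
    rw [demLusWord_cons]
    rcases eq_or_ne (β (lo i)) (β (hi i)) with heq | hne
    · exact eval_point_demLus_of_eq heq (ih hβ)
    · exact eval_point_demLus_of_ne t hne (ih hβ) (ih (by rwa [size_comp]))

end Interpolation

section Chains

variable {σ R : Type*} [DecidableEq σ] [CommRing R] [IsDomain R]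

theorem X_dvd_demLus_sub (s : R) (a b : σ) (f : MvPolynomial σ R) :
    X a ∣ demLus s a b f - C s * rename (Equiv.swap a b) f :=
  ⟨-(C (1 - s) * divDiff a b f), by rw [demLus_apply]; ring⟩

theorem X_dvd_prod_demLus_sub (s : R) {m : ℕ} (e : Fin (m + 1) → σ) (f : MvPolynomial σ R) :
    X (e 0) ∣ ((List.finRange m).map fun i => demLus s (e i.castSucc) (e i.succ)).prod f -
      C (s ^ m) * rename
        ((List.finRange m).map fun i => Equiv.swap (e i.castSucc) (e i.succ)).prod f := by
  induction m with
  | zero => simp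
  | succ m ih =>
    have htail := map_dvd (rename (Equiv.swap (e 0) (e 1))) (ih fun i => e i.succ)
    rw [Fin.succ_zero_eq_one, rename_X, Equiv.swap_apply_right, map_sub, map_mul, rename_C,
      rename_rename, ← Equiv.Perm.coe_mul] at htail
    have hstep := dvd_add (X_dvd_demLus_sub s (e 0) (e 1)
      (((List.finRange m).map fun i => demLus s (e i.castSucc.succ) (e i.succ.succ)).prod f))
      (htail.mul_left (C s))
    simp only [List.finRange_succ, List.map_cons, List.map_map, List.prod_cons,
      Module.End.mul_apply]
    convert! hstep using 1
    rw [pow_succ, C_mul]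
    simp only [Function.comp_def, Fin.castSucc_zero, Fin.succ_zero_eq_one, Fin.castSucc_succ]
    ring

theorem prod_demLus_telescope (s : R) {m : ℕ} {e : Fin (m + 1) → σ} (he : Function.Injective e)
    (f : MvPolynomial σ R) :
    ((List.finRange m).map fun i => demLus s (e i.castSucc) (e i.succ)).prod (X (e (Fin.last m)) *
      ((List.finRange m).reverse.map fun i => demLus s (e i.castSucc) (e i.succ)).prod f) =
      C (s ^ m) * (X (e 0) * f) := by
  induction m generalizing f with
  | zero => simp
  | succ m ih =>
    have htail := ih (he.comp (Fin.succ_injective _)) (demLus s (e 0) (e 1) f)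
    simp only [List.finRange_succ, List.map_cons, List.map_map, List.prod_cons, List.reverse_cons,
      List.map_append, List.prod_append, Module.End.mul_apply, List.map_nil, List.prod_nil,
      ← List.map_reverse]
    simp only [Function.comp_def, Fin.succ_last, Fin.succ_zero_eq_one, Fin.castSucc_zero,
      Fin.castSucc_succ, Module.End.one_apply] at htail ⊢
    rw [htail, ← smul_eq_C_mul, map_smul, demLus_X_mul_demLus _ (he.ne Fin.zero_ne_one),
      smul_eq_C_mul, ← mul_assoc, ← C_mul, pow_succ]

end Chains

section Cycle

variable {n : ℕ} {R : Type*} [CommRing R]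

theorem unshift_rename_simple (c : R) (i : Fin (n - 1)) (f : MvPolynomial (Fin (n + 1)) R) :
    unshift c (rename (simple (n := n + 1) (lo i)) f) =
      rename (simple (n := n + 1) (hi i)) (unshift c f) := by
  suffices h : (unshift c).comp (rename (simple (n := n + 1) (lo i))) =
      (rename (simple (n := n + 1) (hi i))).comp (unshift c) from AlgHom.congr_fun h f
  refine MvPolynomial.algHom_ext fun k => ?_
  refine Fin.lastCases ?_ (fun k => ?_) k
  · simp [simple_lo_last, simple_hi_zero]
  · simp [simple_lo_castSucc, simple_hi_succ]

theorem rename_wordPerm_cycleWord_shift (c : R) (f : MvPolynomial (Fin (n + 1)) R) :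
    X 0 ∣ f - rename (wordPerm (cycleWord n)) (shift c f) := by
  refine dvd_sub_map_of_forall_dvd_X_sub ((rename (wordPerm (cycleWord n))).comp (shift c))
    (fun k => ?_) f
  refine Fin.cases ?_ (fun k => ?_) k
  · rw [AlgHom.comp_apply, shift_X_zero, map_mul, rename_C, rename_X, wordPerm_cycleWord_last]
    exact ⟨1 - C c, by ring⟩
  · rw [AlgHom.comp_apply, shift_X_succ, rename_X, wordPerm_cycleWord_castSucc, sub_self]
    exact dvd_zero _

variable [IsDomain R]

theorem unshift_demLusWord (c s : R) (l : List (Fin (n - 1))) (f : MvPolynomial (Fin (n + 1)) R) :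
    unshift c (demLusWord s (castSuccWord l) f) = demLusWord s (succWord l) (unshift c f) := by
  induction l with
  | nil => rfl
  | cons i l ih =>
    simp only [castSuccWord, succWord, List.map_cons, demLusWord_cons] at ih ⊢
    rw [← ih]
    exact map_demLus (unshift c).toRingHom one_ne_zero (lo_ne_hi (n := n + 1) (hi i))
      (by rw [one_mul]; exact unshift_X_castSucc c (lo i))
      (by rw [one_mul]; exact unshift_X_castSucc c (hi i))
      (algHom_C _ _) (unshift_rename_simple c i) _

theorem demLusWord_succWord_X_zero_mul (s : R) (l : List (Fin (n - 1)))
    (f : MvPolynomial (Fin (n + 1)) R) :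
    demLusWord s (succWord l) (X 0 * f) = X 0 * demLusWord s (succWord l) f := by
  induction l with
  | nil => rfl
  | cons i l ih =>
    simp only [succWord, List.map_cons, demLusWord_cons] at ih ⊢
    have hX : rename (simple (n := n + 1) (hi i)) (X 0 : MvPolynomial (Fin (n + 1)) R) = X 0 := by
      rw [rename_X, simple_hi_zero]
    rw [ih, demLus_mul_of_symm s (lo_ne_hi (n := n + 1) (hi i)) hX]

theorem X_zero_dvd_demLusWord_cycleWord_sub (s : R) (f : MvPolynomial (Fin (n + 1)) R) :
    X 0 ∣ demLusWord s (cycleWord n) f - C (s ^ n) * rename (wordPerm (cycleWord n)) f :=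
  X_dvd_prod_demLus_sub s id f

theorem demLusWord_cycleWord_telescope (s : R) (f : MvPolynomial (Fin (n + 1)) R) :
    demLusWord s (cycleWord n) (X (Fin.last n) * demLusWord s (cycleWord n).reverse f) =
      C (s ^ n) * (X 0 * f) :=
  prod_demLus_telescope s Function.injective_id f

end Cycle

section Conjugation

variable {n : ℕ}

theorem circ_demLus (i : Fin (n - 1)) (f : PolyRing n) :
    circ (demLus t (lo i) (hi i) f) = demLus t⁻¹ (lo i) (hi i) (circ f) :=
  map_demLus (map iota) one_ne_zero (lo_ne_hi i) (by simp) (by simp) (by simp [iota_t])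
    (fun f => map_rename _ _ f) f

theorem rename_longest_circ_shift (f : PolyRing (n + 1)) :
    rename (longest (n + 1)) (circ (shift q⁻¹ f)) =
      unshift q (rename (longest (n + 1)) (circ f)) := by
  have h : ((rename (longest (n + 1))).toRingHom.comp (map iota)).comp (shift q⁻¹).toRingHom =
      ((unshift q).toRingHom.comp (rename (longest (n + 1))).toRingHom).comp (map iota) := by
    refine MvPolynomial.ringHom_ext (fun r => ?_) (fun k => ?_)
    · simp
    · refine Fin.cases ?_ (fun k => ?_) k
      · simp [longest_apply, iota_q]
      · simp [longest_apply, Fin.rev_castSucc, Fin.rev_succ]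
  exact RingHom.congr_fun h f

theorem iota_point (β : Fin n → ℕ) (k : Fin n) : iota (point β k) = (point β k)⁻¹ := by
  rw [point_apply, map_mul, map_zpow₀, map_zpow₀, iota_q, iota_t, mul_inv, inv_zpow, inv_zpow]

end Conjugation

section Interchange

variable {n : ℕ} {α : Fin n → ℕ} {i : Fin (n - 1)}

/-- The scalar `c` for which `(H_i + c) G_α` vanishes at `point α`. -/
def interchangeScalar (α : Fin n → ℕ) (i : Fin (n - 1)) : BaseField :=
  (1 - t) * point α (lo i) / (point α (lo i) - point α (hi i))

/-- The operator `H_i + c` taking `G_α` to `G_(s_i α)` when `α_i < α_(i+1)`. -/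
def interchange (α : Fin n → ℕ) (i : Fin (n - 1)) : Module.End BaseField (PolyRing n) :=
  demLus t (lo i) (hi i) + interchangeScalar α i • 1

theorem interchange_apply (α : Fin n → ℕ) (i : Fin (n - 1)) (f : PolyRing n) :
    interchange α i f = demLus t (lo i) (hi i) f + C (interchangeScalar α i) * f := by
  simp [interchange, smul_eq_C_mul]

theorem t_mul_iota_interchangeScalar (α : Fin n → ℕ) (i : Fin (n - 1)) :
    t * iota (interchangeScalar α i) = interchangeScalar α i - (1 - t) := by
  have hlo := point_ne_zero α (lo i)
  have hhi := point_ne_zero α (hi i)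
  have hsub : point α (lo i) - point α (hi i) ≠ 0 := sub_ne_zero.2 (point_lo_ne_point_hi α i)
  have hsub_inv : (point α (lo i))⁻¹ - (point α (hi i))⁻¹ ≠ 0 :=
    sub_ne_zero.2 (inv_injective.ne (point_lo_ne_point_hi α i))
  have ht := t_ne_zero
  rw [interchangeScalar, map_div₀, map_mul, map_sub, map_sub, map_one, iota_t, iota_point,
    iota_point, mul_div_assoc', div_sub' hsub, div_eq_div_iff hsub_inv hsub]
  field_simp
  ring

theorem interchange_mem_supp_size (P : ℕ → Prop) {f : PolyRing n}
    (hf : f ∈ supp BaseField fun γ => P (size γ)) :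
    interchange α i f ∈ supp BaseField fun γ => P (size γ) := by
  rw [interchange_apply]
  exact Submodule.add_mem _ (demLus_mem_supp_size t (lo_ne_hi i) P hf) (C_mul_mem_supp _ hf)

theorem interchange_mem_below (h : α (lo i) < α (hi i)) {E : PolyRing n}
    (hE : E ∈ supp BaseField (Below · α)) :
    interchange α i E ∈ supp BaseField (Below · (α ∘ simple i)) := by
  rw [interchange_apply]
  exact Submodule.add_mem _ (demLus_mem_below t h hE)
    (C_mul_mem_supp _ (mem_below_comp_simple h hE))

theorem coeff_interchange_of_mem_below (h : α (lo i) < α (hi i)) {E : PolyRing n}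
    (hE : E ∈ supp BaseField (Below · α)) :
    coeff (Finsupp.equivFunOnFinite.symm (α ∘ simple i)) (interchange α i E) =
      coeff (Finsupp.equivFunOnFinite.symm α) E := by
  rw [interchange_apply, coeff_add, coeff_C_mul, coeff_demLus_of_mem_below t h hE,
    coeff_eq_zero_of_mem_supp hE (not_below_comp_simple h), mul_zero, add_zero]

theorem eval_point_interchange_self (h : α (lo i) < α (hi i)) {f : PolyRing n}
    (hf : eval (point (α ∘ simple i)) f = 0) : eval (point α) (interchange α i f) = 0 := by
  have hsub : point α (lo i) - point α (hi i) ≠ 0 := sub_ne_zero.2 (point_lo_ne_point_hi α i)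
  have heval := mul_eval_demLus t (lo i) (hi i) (point α) f
  rw [← simple, ← point_comp_simple h.ne, hf, mul_zero, zero_sub] at heval
  apply mul_left_cancel₀ hsub
  rw [interchange_apply, eval_add, mul_add, heval, eval_mul, eval_C, interchangeScalar, ← mul_assoc,
    mul_div_cancel₀ _ hsub, neg_add_cancel, mul_zero]

theorem eval_point_interchange (h : α (lo i) < α (hi i)) {f : PolyRing n}
    (hf : ∀ β, size β ≤ size α → β ≠ α → eval (point β) f = 0) {β : Fin n → ℕ}
    (hβ : size β ≤ size α) (hβα : β ≠ α ∘ simple i) : eval (point β) (interchange α i f) = 0 := by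
  rcases eq_or_ne β α with rfl | hne
  · exact eval_point_interchange_self h (hf _ (size_comp _ _).le hβα.symm)
  have hβi : eval (point (β ∘ simple i)) f = 0 :=
    hf _ (by rwa [size_comp]) fun heq => hβα (by rw [← heq, comp_simple_comp_simple])
  rw [interchange_apply, eval_add, eval_mul, hf β hβ hne, mul_zero, add_zero]
  rcases eq_or_ne (β (lo i)) (β (hi i)) with hlo | hlo
  · exact eval_point_demLus_of_eq hlo (hf β hβ hne)
  · exact eval_point_demLus_of_ne t hlo (hf β hβ hne) hβi

theorem demLusWord_interchange {l : List (Fin (n - 1))} (hl : IsReducedWord l (longest n))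
    {c : BaseField} {E : PolyRing n}
    (hE : demLusWord t l E = C c * rename (longest n) (circ E)) :
    demLusWord t l (interchange α i E) =
      C (c * t) * rename (longest n) (circ (interchange α i E)) := by
  have hscalar := congrArg (C : BaseField → PolyRing n) (t_mul_iota_interchangeScalar α i)
  have hrename := C_mul_rename_longest_demLus (mul_inv_cancel₀ t_ne_zero) i (circ E)
  have hcirc : circ (interchange α i E) =
      demLus t⁻¹ (lo i) (hi i) (circ E) + C (iota (interchangeScalar α i)) * circ E := by
    rw [← circ_demLus, interchange_apply]
    simp [circ]
  rw [C_mul, C_sub] at hscalar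
  have hword : demLusWord t l (interchange α i E) =
      C c * demLus t (lo i.rev) (hi i.rev) (rename (longest n) (circ E)) +
        C (interchangeScalar α i) * (C c * rename (longest n) (circ E)) := by
    rw [interchange_apply, map_add, demLusWord_longest_demLus t hl, hE]
    simp only [← smul_eq_C_mul, map_smul, hE]
  rw [hword, hcirc, map_add, C_mul, map_mul (rename _), rename_C]
  linear_combination -C c * hrename - C c * rename (longest n) (circ E) * hscalar

end Interchange

section Raise

variable {n : ℕ} {α : Fin (n + 1) → ℕ}

/-- The operator `f ↦ (x_n - t^(1-n)) f(x_n / q, x_1, …, x_(n-1))`, which takes `G_α` to a multiple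
of `G_(α_2, …, α_n, α_1 + 1)`. The number of variables, `n` in this formula, is `n + 1` in the
code. -/
def raise (f : PolyRing (n + 1)) : PolyRing (n + 1) :=
  (X (Fin.last n) - C (t ^ (-(n : ℤ)))) * shift q⁻¹ f

theorem raise_mem_degreeLT {d : ℕ} {f : PolyRing (n + 1)}
    (hf : f ∈ degreeLT BaseField (n + 1) d) : raise f ∈ degreeLT BaseField (n + 1) (d + 1) :=
  mul_mem_degreeLT (totalDegree_X_sub_C_le _ _) (shift_mem_degreeLT _ hf)

theorem raise_sub_mem_degreeLT {d : ℕ} {G E : PolyRing (n + 1)}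
    (hG : G ∈ degreeLT BaseField (n + 1) (d + 1)) (hGE : G - E ∈ degreeLT BaseField (n + 1) d) :
    raise G - X (Fin.last n) * shift q⁻¹ E ∈ degreeLT BaseField (n + 1) (d + 1) := by
  have heq : raise G - X (Fin.last n) * shift q⁻¹ E =
      X (Fin.last n) * shift q⁻¹ (G - E) - C (t ^ (-(n : ℤ))) * shift q⁻¹ G := by
    rw [raise, map_sub]
    ring
  rw [heq]
  exact Submodule.sub_mem _ (mul_mem_degreeLT (totalDegree_X_le _) (shift_mem_degreeLT _ hGE))
    (C_mul_mem_supp _ (shift_mem_degreeLT _ hG))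

theorem eval_point_raise {f : PolyRing (n + 1)}
    (hf : ∀ β, size β ≤ size α → β ≠ α → eval (point β) f = 0) {β : Fin (n + 1) → ℕ}
    (hβ : size β ≤ size α + 1) (hne : β ≠ Fin.snoc (Fin.tail α) (α 0 + 1)) :
    eval (point β) (raise f) = 0 := by
  rw [← Fin.snoc_init_self β] at hβ hne ⊢
  rw [raise, eval_mul, eval_sub, eval_X, eval_C]
  rcases hb : β (Fin.last n) with _ | b
  · rw [point_snoc_zero, Fin.snoc_last, sub_self, zero_mul]
  · rw [hb, size_snoc] at hβ
    rw [eval_point_shift]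
    refine mul_eq_zero_of_right _ (hf _ (by rw [size_cons]; omega) fun heq => hne ?_)
    rw [hb, ← heq, Fin.tail_cons, Fin.cons_zero]

theorem X_zero_dvd_add_demLusWord_raise (f : PolyRing (n + 1)) :
    X 0 ∣ f + demLusWord t (cycleWord n) (raise f) := by
  set g := rename (wordPerm (cycleWord n)) (shift q⁻¹ f)
  obtain ⟨A, hA⟩ := X_zero_dvd_demLusWord_cycleWord_sub t (raise f)
  obtain ⟨B, hB⟩ : X 0 ∣ f - g := rename_wordPerm_cycleWord_shift q⁻¹ f
  have hraise : rename (wordPerm (cycleWord n)) (raise f) = (X 0 - C (t ^ (-(n : ℤ)))) * g := by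
    rw [raise, map_mul, map_sub, rename_C, rename_X, wordPerm_cycleWord_last]
  have ht : (C (t ^ n) * C (t ^ (-(n : ℤ))) : PolyRing (n + 1)) = 1 := by
    rw [← C_mul, zpow_neg, zpow_natCast, mul_inv_cancel₀ (pow_ne_zero _ t_ne_zero), C_1]
  rw [hraise] at hA
  exact ⟨A + B + C (t ^ n) * g, by linear_combination hA + hB - g * ht⟩

theorem IsInterpolation.eval_point_demLusWord_raise {G : PolyRing (n + 1)}
    (h : IsInterpolation α G) (l : List (Fin (n + 1 - 1))) {β : Fin (n + 1) → ℕ}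
    (hβ : size β ≤ size α) :
    eval (point β) (demLusWord t l (raise G)) = 0 := by
  refine eval_point_demLusWord (d := size α + 1) (fun γ hγ => ?_) l (Nat.lt_succ_of_le hβ)
  refine eval_point_raise h.vanishing hγ.le fun heq => hγ.ne ?_
  conv_rhs => rw [← Fin.cons_self_tail α, size_cons]
  rw [heq, size_snoc]
  omega

theorem IsInterpolation.add_demLusWord_raise {G : PolyRing (n + 1)} (h : IsInterpolation α G) :
    G + demLusWord t (cycleWord n) (raise G) = C (point α 0)⁻¹ * (X 0 * G) := by
  obtain ⟨M, hM⟩ := X_zero_dvd_add_demLusWord_raise G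
  have hdegree : M ∈ degreeLT BaseField (n + 1) (size α + 1) := by
    refine mem_degreeLT_of_X_mul_mem (k := 0) ?_
    rw [← hM]
    exact Submodule.add_mem _ (supp_mono (fun _ => Nat.lt_succ_of_lt) h.mem_degreeLT)
      (demLusWord_mem_supp_size t _ (· < size α + 1 + 1) (raise_mem_degreeLT h.mem_degreeLT))
  have heval (β) (hβ : size β ≤ size α) : point β 0 * eval (point β) M = eval (point β) G := by
    have hMβ := congrArg (eval (point β)) hM
    rwa [eval_add, h.eval_point_demLusWord_raise _ hβ, add_zero, eval_mul, eval_X, eq_comm] at hMβ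
  have hM_eq := h.eq_C_mul hdegree fun β hβ hne =>
    (mul_eq_zero.1 ((heval β hβ).trans (h.vanishing β hβ hne))).resolve_left (point_ne_zero β 0)
  have hne : eval (point α) M ≠ 0 :=
    right_ne_zero_of_mul ((heval α le_rfl).trans_ne h.eval_point_ne_zero)
  rw [← heval α le_rfl, div_mul_cancel_right₀ hne] at hM_eq
  rw [hM, hM_eq, mul_left_comm]

end Raise

/-- `G` is the interpolation polynomial of index `α` and `E` its top homogeneous part, with the two
properties of `E` that make the induction run: it is triangular, and `w_0 H_(w_0)` inverts `q` and
`t` in it up to a power of `t`. -/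
structure IsTriangular {n : ℕ} (α : Fin n → ℕ) (G E : PolyRing n) : Prop where
  sub_mem : G - E ∈ degreeLT BaseField n (size α)
  vanishing : ∀ β, size β ≤ size α → β ≠ α → eval (point β) G = 0
  below : E ∈ supp BaseField (Below · α)
  coeff_eq_one : coeff (Finsupp.equivFunOnFinite.symm α) E = 1
  inversion : ∀ l, IsReducedWord l (longest n) →
    demLusWord t l E = C (t ^ invCount α) * rename (longest n) (circ E)

namespace IsTriangular

section Basic

variable {n : ℕ} {α : Fin n → ℕ} {G E : PolyRing n}

theorem mem_degreeEq (h : IsTriangular α G E) : E ∈ degreeEq BaseField n (size α) :=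
  supp_mono (fun _ hγ => hγ.1) h.below

theorem mem_degreeLT (h : IsTriangular α G E) : G ∈ degreeLT BaseField n (size α + 1) := by
  rw [← sub_add_cancel G E]
  exact Submodule.add_mem _ (supp_mono (fun _ => Nat.lt_succ_of_lt) h.sub_mem)
    (supp_mono (fun _ hγ => Nat.lt_succ_of_le hγ.le) h.mem_degreeEq)

theorem isInterpolation (h : IsTriangular α G E) : IsInterpolation α G where
  degree_le := mem_degreeLT_succ.1 h.mem_degreeLT
  vanishing := h.vanishing
  coeff_eq_one := by
    rw [← sub_add_cancel G E, coeff_add, coeff_eq_zero_of_mem_supp h.sub_mem (lt_irrefl _),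
      h.coeff_eq_one, zero_add]

theorem zero : IsTriangular (0 : Fin n → ℕ) 1 1 where
  sub_mem := by
    rw [sub_self]
    exact Submodule.zero_mem _
  vanishing β hβ hne := by
    refine absurd (funext fun k => ?_) hne
    have hzero : size (0 : Fin n → ℕ) = 0 := Finset.sum_const_zero
    rw [hzero, Nat.le_zero] at hβ
    exact Finset.sum_eq_zero_iff.1 hβ k (Finset.mem_univ k)
  below := by
    have hmon : (1 : PolyRing n) = mon 0 := by simp [mon_eq_prod]
    rw [hmon]
    exact mon_mem_supp ⟨rfl, fun _ _ => le_rfl⟩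
  coeff_eq_one := by
    have hmon : (1 : PolyRing n) = mon 0 := by simp [mon_eq_prod]
    rw [hmon, coeff_mon_self]
  inversion l hl := by
    rw [demLusWord_one, (isReducedWord_iff.1 hl).2, inversions_longest, circ, map_one, map_one,
      mul_one]
    rfl

theorem interchange (h : IsTriangular α G E) {i : Fin (n - 1)} (hi : α (lo i) < α (hi i)) :
    IsTriangular (α ∘ simple i) (interchange α i G) (interchange α i E) where
  sub_mem := by
    rw [← map_sub, size_comp]
    exact interchange_mem_supp_size (· < size α) h.sub_mem
  vanishing β hβ hne := eval_point_interchange hi h.vanishing (by rwa [size_comp] at hβ) hne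
  below := interchange_mem_below hi h.below
  coeff_eq_one := by rw [coeff_interchange_of_mem_below hi h.below, h.coeff_eq_one]
  inversion l hl := by
    rw [demLusWord_interchange hl (h.inversion l hl), invCount_comp_simple hi, pow_succ]

end Basic

section Raise

variable {n : ℕ} {α : Fin (n + 1) → ℕ} {G E : PolyRing (n + 1)}

theorem demLusWord_cycleWord_X_last_mul_shift (h : IsTriangular α G E) :
    demLusWord t (cycleWord n) (X (Fin.last n) * shift q⁻¹ E) =
      C (point α 0)⁻¹ * (X 0 * E) := by
  have hsub : demLusWord t (cycleWord n) (X (Fin.last n) * shift q⁻¹ E) -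
      C (point α 0)⁻¹ * (X 0 * E) = C (point α 0)⁻¹ * (X 0 * (G - E)) - G -
        demLusWord t (cycleWord n) (raise G - X (Fin.last n) * shift q⁻¹ E) := by
    rw [map_sub]
    linear_combination h.isInterpolation.add_demLusWord_raise
  rw [← sub_eq_zero]
  refine eq_zero_of_mem_degreeLT_of_mem_degreeEq (d := size α + 1) ?_ ?_
  · rw [hsub]
    exact Submodule.sub_mem _ (Submodule.sub_mem _
      (C_mul_mem_supp _ (mul_mem_degreeLT (totalDegree_X_le _) h.sub_mem)) h.mem_degreeLT)
      (demLusWord_mem_supp_size t _ (· < size α + 1)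
        (raise_sub_mem_degreeLT h.mem_degreeLT h.sub_mem))
  · exact Submodule.sub_mem _
      (demLusWord_mem_supp_size t _ (· = size α + 1)
        (X_last_mul_shift_mem_degreeEq _ h.mem_degreeEq))
      (C_mul_mem_supp _ (X_mul_mem_degreeEq 0 h.mem_degreeEq))

theorem demLusWord_cycleWord_reverse (h : IsTriangular α G E) :
    demLusWord t (cycleWord n).reverse E = C (t ^ n * point α 0) * shift q⁻¹ E := by
  refine mul_left_cancel₀ (X_ne_zero (Fin.last n)) (demLusWord_injective t_ne_zero (cycleWord n) ?_)
  rw [demLusWord_cycleWord_telescope, ← smul_eq_C_mul (shift q⁻¹ E), mul_smul_comm, map_smul,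
    smul_eq_C_mul, h.demLusWord_cycleWord_X_last_mul_shift, ← mul_assoc (C _) (C _), ← C_mul,
    mul_inv_cancel_right₀ (point_ne_zero α 0)]

theorem C_mul_demLusWord_succWord (h : IsTriangular α G E) {l : List (Fin (n - 1))}
    (hl : IsReducedWord l (longest n)) :
    C (t ^ n * point α 0) * demLusWord t (succWord l) E =
      C (t ^ invCount α) * unshift q (rename (longest (n + 1)) (circ E)) := by
  have hinv := congrArg (unshift q) (h.inversion _ hl.castSuccWord_append)
  rw [demLusWord_append, unshift_demLusWord, h.demLusWord_cycleWord_reverse,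
    map_mul (unshift q), map_mul (unshift q), algHom_C, algHom_C, algebraMap_eq,
    unshift_shift (mul_inv_cancel₀ q_ne_zero)] at hinv
  rwa [← smul_eq_C_mul E, map_smul, smul_eq_C_mul] at hinv

theorem demLusWord_longest_X_last_mul_shift (h : IsTriangular α G E)
    {l : List (Fin (n + 1 - 1))} (hl : IsReducedWord l (longest (n + 1))) :
    demLusWord t l (X (Fin.last n) * shift q⁻¹ E) =
      C (t ^ invCount α / (t ^ n * point α 0 ^ 2)) *
        rename (longest (n + 1)) (circ (X (Fin.last n) * shift q⁻¹ E)) := by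
  obtain ⟨m, hm⟩ := exists_isReducedWord (longest n)
  have hcirc : rename (longest (n + 1)) (circ (X (Fin.last n) * shift q⁻¹ E)) =
      X 0 * unshift q (rename (longest (n + 1)) (circ E)) := by
    rw [← rename_longest_circ_shift]
    simp only [circ, map_mul, map_X, rename_X, longest_apply, Fin.rev_last]
  have hunshift : unshift q (rename (longest (n + 1)) (circ E)) =
      C (t ^ n * point α 0 / t ^ invCount α) * demLusWord t (succWord m) E := by
    refine mul_left_cancel₀ (C_ne_zero.2 (pow_ne_zero (invCount α) t_ne_zero)) ?_
    rw [← h.C_mul_demLusWord_succWord hm, ← mul_assoc, ← C_mul,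
      mul_div_cancel₀ _ (pow_ne_zero _ t_ne_zero)]
  have hscalar : t ^ invCount α / (t ^ n * point α 0 ^ 2) * (t ^ n * point α 0 / t ^ invCount α) =
      (point α 0)⁻¹ := by
    have ht := t_ne_zero
    have hpoint := point_ne_zero α 0
    field_simp
  rw [demLusWord_eq_of_isReducedWord t hl hm.succWord_append, demLusWord_append,
    h.demLusWord_cycleWord_X_last_mul_shift, ← smul_eq_C_mul, map_smul,
    demLusWord_succWord_X_zero_mul, hcirc, hunshift, mul_left_comm (X 0), ← mul_assoc (C _) (C _),
    ← C_mul, hscalar, smul_eq_C_mul]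

end Raise

end IsTriangular

section Existence

variable {n : ℕ}

theorem invCount_snoc_succ_add (a : ℕ) (β : Fin n → ℕ) :
    invCount (Fin.snoc β (a + 1) : Fin (n + 1) → ℕ) + n =
      invCount (Fin.cons a β : Fin (n + 1) → ℕ) +
        2 * kComp (Fin.cons a β : Fin (n + 1) → ℕ) 0 := by
  have hcard := Finset.card_filter_add_card_filter_not (s := (Finset.univ : Finset (Fin n)))
    (fun k => β k ≤ a)
  simp only [not_le, Finset.card_univ, Fintype.card_fin] at hcard
  rw [invCount_snoc, invCount_cons, kComp_cons_zero]
  simp only [Nat.succ_le_iff]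
  omega

theorem q_pow_mul_t_pow_div (a : ℕ) (β : Fin n → ℕ) :
    q ^ a * (t ^ invCount (Fin.cons a β : Fin (n + 1) → ℕ) /
        (t ^ n * point (Fin.cons a β : Fin (n + 1) → ℕ) 0 ^ 2)) =
      t ^ invCount (Fin.snoc β (a + 1) : Fin (n + 1) → ℕ) * (q ^ a)⁻¹ := by
  have hpow := congrArg (t ^ ·) (invCount_snoc_succ_add a β)
  have hq := q_ne_zero
  have ht := t_ne_zero
  simp only [pow_add, pow_mul'] at hpow
  rw [point_apply, zpow_neg, zpow_natCast, zpow_natCast, Fin.cons_zero]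
  field_simp
  linear_combination -hpow

theorem IsTriangular.raise {a : ℕ} {β : Fin n → ℕ} {G E : PolyRing (n + 1)}
    (h : IsTriangular (Fin.cons a β : Fin (n + 1) → ℕ) G E) :
    IsTriangular (Fin.snoc β (a + 1) : Fin (n + 1) → ℕ) (C (q ^ a) * InterpolationMacdonald.raise G)
      (C (q ^ a) * (X (Fin.last n) * shift q⁻¹ E)) := by
  have hsize : size (Fin.snoc β (a + 1) : Fin (n + 1) → ℕ) =
      size (Fin.cons a β : Fin (n + 1) → ℕ) + 1 := by
    rw [size_snoc, size_cons]
    omega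
  refine ⟨?_, fun γ hγ hne => ?_, ?_, ?_, fun l hl => ?_⟩
  · rw [← mul_sub, hsize]
    exact C_mul_mem_supp _ (raise_sub_mem_degreeLT h.mem_degreeLT h.sub_mem)
  · rw [eval_mul, eval_point_raise h.vanishing (hγ.trans_eq hsize), mul_zero]
    rwa [Fin.tail_cons, Fin.cons_zero]
  · exact C_mul_mem_supp _ (X_last_mul_shift_mem_supp _ (P := (Below · (Fin.cons a β)))
      (Q := (Below · (Fin.snoc β (a + 1)))) (fun _ _ => below_snoc_succ) h.below)
  · rw [coeff_C_mul, coeff_X_last_mul_shift, h.coeff_eq_one, mul_one, ← mul_pow,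
      mul_inv_cancel₀ q_ne_zero, one_pow]
  · have hcirc (f : PolyRing (n + 1)) : circ (C (q ^ a) * f) = C (q ^ a)⁻¹ * circ f := by
      rw [circ, map_mul, map_C, map_pow, iota_q, inv_pow]
      rfl
    rw [← smul_eq_C_mul, map_smul, h.demLusWord_longest_X_last_mul_shift hl, smul_eq_C_mul,
      ← mul_assoc, ← C_mul, q_pow_mul_t_pow_div, smul_eq_C_mul, hcirc, map_mul (rename _), rename_C,
      ← mul_assoc, ← C_mul]

theorem exists_lt_of_last_eq_zero {α : Fin (n + 1) → ℕ} (h : α (Fin.last n) = 0) (hα : α ≠ 0) :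
    ∃ i : Fin (n + 1 - 1), α (hi i) < α (lo i) := by
  by_contra! hle
  exact hα (funext fun k => Nat.le_zero.1 ((monotone_of_lo_le_hi hle (Fin.le_last k)).trans_eq h))

theorem exists_isTriangular (α : Fin n → ℕ) : ∃ G E, IsTriangular α G E := by
  rcases n with _ | n
  · rw [Subsingleton.elim α 0]
    exact ⟨1, 1, .zero⟩
  induction hd : size α using Nat.strong_induction_on generalizing α with
  | _ d ih_size =>
    induction hk : invCount α using Nat.strong_induction_on generalizing α with
    | _ k ih_inv =>
      rcases hlast : α (Fin.last n) with _ | a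
      · rcases eq_or_ne α 0 with rfl | hα
        · exact ⟨1, 1, .zero⟩
        obtain ⟨i, hi⟩ := exists_lt_of_last_eq_zero hlast hα
        have hinv := invCount_comp_simple_add_one hi
        obtain ⟨G, E, h⟩ := ih_inv _ (by omega) (α ∘ simple i) (by rw [size_comp, hd]) rfl
        have hraise := h.interchange (i := i) (by simpa [simple_lo, simple_hi] using hi)
        rw [comp_simple_comp_simple] at hraise
        exact ⟨_, _, hraise⟩
      · rw [← Fin.snoc_init_self α, hlast] at hd ⊢
        rw [size_snoc] at hd
        obtain ⟨G, E, h⟩ := ih_size _ (by omega) (Fin.cons a (Fin.init α)) (size_cons _ _)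
        exact ⟨_, _, h.raise⟩

end Existence

section Primed

variable {n : ℕ} {α : Fin n → ℕ} {G E : PolyRing n} {l : List (Fin (n - 1))}

theorem rename_longest_rename_longest (f : PolyRing n) :
    rename (longest n) (rename (longest n) f) = f := by
  have hlongest : ⇑(longest n) ∘ ⇑(longest n) = id := funext Fin.rev_rev
  rw [rename_rename, hlongest, rename_id_apply]

theorem eval_tilde (β : Fin n → ℕ) (f : PolyRing n) :
    eval (tilde fun i => (β i : ℤ)) f = iota (eval (point β) (rename (longest n) (dual f))) := by
  have h := eval_dual (point β ∘ longest n) (dual f)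
  rw [tilde_eq]
  rwa [dual_dual, ← eval_rename] at h

theorem IsPrimedInterpolation.unique {P Q : PolyRing n} (hP : IsPrimedInterpolation α G P)
    (hQ : IsPrimedInterpolation α G Q) : P = Q := by
  have hlow : P - Q ∈ degreeLT BaseField n (size α) := by
    have hdegree := (totalDegree_sub P Q).trans (max_le hP.degree_le hQ.degree_le)
    rw [mem_degreeLT_iff_homogeneousComponent_eq_zero hdegree, map_sub, hP.top_eq, hQ.top_eq,
      sub_self]
  have hzero : rename (longest n) (dual (P - Q)) = 0 := by
    refine eq_zero_of_vanishing
      (rename_mem_supp_size _ (· < size α) (dual_mem_supp hlow)) fun β hβ => ?_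
    rw [← map_eq_zero iota, ← eval_tilde, eval_sub, hP.vanishing β hβ, hQ.vanishing β hβ, sub_self]
  rw [← sub_eq_zero, ← dual_dual (P - Q), ← rename_longest_rename_longest (dual (P - Q)), hzero,
    map_zero, map_zero]

/-- The right hand side of the formula for `G'_α(t^(n-1) x; q⁻¹, t⁻¹)`, with `G` in place of `G_α`
and a word `l` in place of a reduced word of `w_0`. -/
def primedDual (α : Fin n → ℕ) (l : List (Fin (n - 1))) (G : PolyRing n) : PolyRing n :=
  C (t ^ (((n : ℤ) - 1) * (size α : ℤ) - (invCount α : ℤ))) * rename (longest n) (demLusWord t l G)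

theorem primedDual_sub (α : Fin n → ℕ) (l : List (Fin (n - 1))) (G E : PolyRing n) :
    primedDual α l (G - E) = primedDual α l G - primedDual α l E := by
  simp only [primedDual, map_sub, mul_sub]

theorem primedDual_mem_supp_size (α : Fin n → ℕ) (l : List (Fin (n - 1))) (P : ℕ → Prop)
    (hG : G ∈ supp BaseField fun γ => P (size γ)) :
    primedDual α l G ∈ supp BaseField fun γ => P (size γ) :=
  C_mul_mem_supp _ (rename_mem_supp_size _ P (demLusWord_mem_supp_size t l P hG))

theorem dual_primedDual (α : Fin n → ℕ) (l : List (Fin (n - 1))) (G : PolyRing n) :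
    dual (primedDual α l G) =
      C (t ^ ((1 - (n : ℤ)) * (size α : ℤ) + (invCount α : ℤ))) *
        rename (longest n) (demLusWord t⁻¹ l (dual G)) := by
  have hexponent : -(((n : ℤ) - 1) * (size α : ℤ) - (invCount α : ℤ)) =
      (1 - (n : ℤ)) * (size α : ℤ) + (invCount α : ℤ) := by ring
  rw [primedDual, map_mul, dual_C, dual_rename, dual_demLusWord, map_zpow₀, iota_t, inv_zpow',
    hexponent]

theorem IsTriangular.primedDual_top (h : IsTriangular α G E) (hl : IsReducedWord l (longest n)) :
    primedDual α l E = dual E := by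
  rw [primedDual, h.inversion l hl, map_mul, rename_C, rename_longest_rename_longest, ← mul_assoc,
    ← C_mul, dual_eq_C_mul_circ h.mem_degreeEq, ← zpow_natCast t, ← zpow_add₀ t_ne_zero,
    sub_add_cancel, ← zpow_natCast, ← zpow_mul]

theorem IsTriangular.dual_primedDual_sub_mem_degreeLT (h : IsTriangular α G E)
    (hl : IsReducedWord l (longest n)) :
    dual (primedDual α l G) - G ∈ degreeLT BaseField n (size α) := by
  have hdual := dual_mem_supp (primedDual_mem_supp_size α l (· < size α) h.sub_mem)
  rw [primedDual_sub, h.primedDual_top hl, map_sub, dual_dual] at hdual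
  rw [← sub_sub_sub_cancel_right _ G E]
  exact Submodule.sub_mem _ hdual h.sub_mem

theorem IsTriangular.isPrimedInterpolation (h : IsTriangular α G E)
    (hl : IsReducedWord l (longest n)) : IsPrimedInterpolation α G (dual (primedDual α l G)) := by
  have hdegree : (dual (primedDual α l G)).totalDegree ≤ size α :=
    mem_degreeLT_succ.1
      (dual_mem_supp (primedDual_mem_supp_size α l (· < size α + 1) h.mem_degreeLT))
  refine ⟨hdegree, ?_, fun β hβ => ?_⟩
  · have hsub := (totalDegree_sub _ G).trans (max_le hdegree h.isInterpolation.degree_le)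
    rw [← sub_eq_zero, ← map_sub, ← mem_degreeLT_iff_homogeneousComponent_eq_zero hsub]
    exact h.dual_primedDual_sub_mem_degreeLT hl
  · have hvanishing (γ) (hγ : size γ < size α) : eval (point γ) G = 0 :=
      h.vanishing γ hγ.le fun heq => hγ.ne (congrArg size heq)
    rw [eval_tilde, dual_dual, primedDual, map_mul, rename_longest_rename_longest, rename_C,
      eval_mul, eval_point_demLusWord hvanishing l hβ, mul_zero, map_zero]

theorem algebraMap_C_mul (c : BaseField) (f : PolyRing n) :
    algebraMap (PolyRing n) (RatFun n) (C c * f) = c • algebraMap (PolyRing n) (RatFun n) f := by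
  rw [← smul_eq_C_mul]
  exact map_smul (IsScalarTower.toAlgHom BaseField (PolyRing n) (RatFun n)) c f

end Primed

end InterpolationMacdonald

end

theorem theoremA (n : ℕ) (α : Fin n → ℕ) :
    (∃! G : PolyRing n, IsInterpolation α G) ∧
    ∀ G : PolyRing n, IsInterpolation α G →
      (∃! G' : PolyRing n, IsPrimedInterpolation α G G') ∧
      ∀ G' : PolyRing n, IsPrimedInterpolation α G G' →
        ∀ l : List (Fin (n - 1)), IsReducedWord l (longest n) →
          algebraMap (PolyRing n) (RatFun n) G' =
            t ^ ((1 - (n : ℤ)) * (size α : ℤ) + (invCount α : ℤ)) •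
              permute (longest n) (heckeWord t⁻¹ l
                (algebraMap (PolyRing n) (RatFun n) (scale (t ^ ((n : ℤ) - 1)) (circ G)))) ∧
          algebraMap (PolyRing n) (RatFun n) (scale (t ^ ((n : ℤ) - 1)) (circ G')) =
            t ^ (((n : ℤ) - 1) * (size α : ℤ) - (invCount α : ℤ)) •
              permute (longest n) (heckeWord t l (algebraMap (PolyRing n) (RatFun n) G)) := by
  obtain ⟨G₀, E, h⟩ := exists_isTriangular α
  refine ⟨⟨G₀, h.isInterpolation, fun F hF => hF.unique h.isInterpolation⟩, fun G hG => ?_⟩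
  obtain rfl := h.isInterpolation.unique hG
  obtain ⟨l₀, hl₀⟩ := exists_isReducedWord (longest n)
  refine ⟨⟨_, h.isPrimedInterpolation hl₀, fun P hP => hP.unique (h.isPrimedInterpolation hl₀)⟩,
    fun G' hG' l hl => ?_⟩
  have hG'_eq : G' = dual (primedDual α l G₀) := hG'.unique (h.isPrimedInterpolation hl)
  constructor
  · rw [heckeWord_algebraMap, permute_algebraMap, ← algebraMap_C_mul, hG'_eq, dual_primedDual,
      dual_apply]
  · change algebraMap (PolyRing n) (RatFun n) (dual G') = _
    rw [heckeWord_algebraMap, permute_algebraMap, ← algebraMap_C_mul, hG'_eq, dual_dual, primedDual]
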